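/- Let $\delta>0$. Let $C^\omega_\delta(S)$ be the real Banach space of real analytic $2\pi$-periodic functions $f:\mathbb R\to\mathbb R$ that extend to a bounded holomorphic function on the strip $\{z\in\mathbb C: |\operatorname{Im} z|<\delta\}$, with the norm $\|f\|=\sup_{|\operatorname{Im} z|<\delta}|f(z)|$. For $f\in C^\omega_\delta(S)$ consider the family of circle maps $F_{r,a}: x\mapsto x+2\pi r+a f(x) \pmod{2\pi}$, $r,a\in\mathbb R$; for small $|a|$ these are diffeomorphisms of the circle. Let $N(g)\in\{0,1,2,\dots,\infty\}$ be the number of attracting (that is, asymptotically stable) periodic trajectories of a circle map $g$, let $\rho(g)\in\mathbb R/\mathbb Z$ be its rotation number, and put $$B(F,\rho_0)=\limsup_{a_1\to 0+}\ \sup\{N(F_{r,a}) : r\in\mathbb R,\ |a|<a_1,\ \rho(F_{r,a})=\rho_0 \bmod 1\}.$$ The infinitesimal cyclicity of the family $F$ is said to be essentially bounded by $1$ if there exists $Q\in\mathbb N$ such that $B(F,p/q)\le 1$ for all coprime $p,q\in\mathbb N$ with $q\ge \max(Q,1)$. Let $\mathcal{IC}^e_1(C^\omega_\delta(S))$ be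 the set of all $f\in C^\omega_\delta(S)$ whose family has infinitesimal cyclicity essentially bounded by $1$. A Borel subset $E$ of a real Banach space $X$ is called Haar null if there is a Borel probability measure $\mu$ on $X$ with $\mu(x+E)=0$ for all $x\in X$; the complement of a Haar null set is called Haar prevalent. **Theorem.** For every $\delta>0$ the set $\mathcal{IC}^e_1(C^\omega_\delta(S))$ is Haar prevalent in $C^\omega_\delta(S)$. In other words, its complement $E$ is a Borel set, and there is a Borel probability measure $\mu$ on $C^\omega_\delta(S)$ such that $\mu(f+E)=0$ for every $f\in C^\omega_\delta(S)$. -/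

import Mathlib

open Real Filter Topology MeasureTheory

open scoped BoundedContinuousFunction

/-! ### The space of analytic functions on the circle -/

/-- The open horizontal strip `ℝ × (-δ i, δ i)` in the complex plane. -/
def strip (δ : ℝ) : Set ℂ := {z | |z.im| < δ}

/-- The real vector space of bounded functions on the strip which are holomorphic there,
`2π`-periodic, and real on the real axis, with the sup norm over the strip inherited from the
bounded continuous functions.  An element is the (unique) analytic continuation to the strip of a
real analytic `2π`-periodic function on the line. -/
def analyticSubmodule (δ : ℝ) : Submodule ℝ (strip δ →ᵇ ℂ) where
  carrier := {h | ∃ H : ℂ → ℂ, DifferentiableOn ℂ H (strip δ) ∧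
    (∀ z : strip δ, h z = H z) ∧
    (∀ z ∈ strip δ, H (z + ((2 * π : ℝ) : ℂ)) = H z) ∧
    (∀ x : ℝ, (x : ℂ) ∈ strip δ → (H x).im = 0)}
  add_mem' := by
    rintro h₁ h₂ ⟨H₁, hd₁, he₁, hp₁, hr₁⟩ ⟨H₂, hd₂, he₂, hp₂, hr₂⟩
    refine ⟨H₁ + H₂, hd₁.add hd₂, ?_, ?_, ?_⟩
    · intro z
      simp [he₁ z, he₂ z]
    · intro z hz
      simp only [Pi.add_apply, hp₁ z hz, hp₂ z hz]
    · intro x hx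
      simp [hr₁ x hx, hr₂ x hx]
  zero_mem' := ⟨0, differentiableOn_const 0, by simp, by simp, by simp⟩
  smul_mem' := by
    rintro c h ⟨H, hd, he, hp, hr⟩
    refine ⟨c • H, hd.const_smul c, ?_, ?_, ?_⟩
    · intro z
      simp [he z]
    · intro z hz
      simp only [Pi.smul_apply, hp z hz]
    · intro x hx
      simp [hr x hx]

/-- The space `C^ω_δ(S)` with norm `sup {|f z| : |Im z| < δ}`. -/
abbrev AnalyticCircleSpace (δ : ℝ) : Type := analyticSubmodule δ

/-- The space `C^ω_δ(S)` carries its Borel σ-algebra. -/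
noncomputable instance (δ : ℝ) : MeasurableSpace (AnalyticCircleSpace δ) := borel _

instance (δ : ℝ) : BorelSpace (AnalyticCircleSpace δ) := ⟨rfl⟩

theorem real_mem_strip {δ : ℝ} (hδ : 0 < δ) (x : ℝ) : (x : ℂ) ∈ strip δ := by
  simpa [strip] using hδ

/-- The real `2π`-periodic function on the line given by an element of `C^ω_δ(S)`. -/
noncomputable def AnalyticCircleSpace.toRealFun {δ : ℝ} (hδ : 0 < δ)
    (f : AnalyticCircleSpace δ) (x : ℝ) : ℝ :=
  (f.1 ⟨(x : ℂ), real_mem_strip hδ x⟩).re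

theorem AnalyticCircleSpace.periodic_toRealFun {δ : ℝ} (hδ : 0 < δ)
    (f : AnalyticCircleSpace δ) : Function.Periodic (f.toRealFun hδ) (2 * π) := by
  intro x
  obtain ⟨H, -, he, hp, -⟩ := f.2
  have h := hp x (real_mem_strip hδ x)
  have h2 : f.1 ⟨((x + 2 * π : ℝ) : ℂ), real_mem_strip hδ _⟩
      = f.1 ⟨(x : ℂ), real_mem_strip hδ x⟩ := by
    rw [he, he]
    simp only [Complex.ofReal_add, h]
  unfold AnalyticCircleSpace.toRealFun
  rw [h2]

/-- The same function, on the circle `ℝ / 2πℤ`. -/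
noncomputable def AnalyticCircleSpace.toCircleFun {δ : ℝ} (hδ : 0 < δ)
    (f : AnalyticCircleSpace δ) : AddCircle (2 * π) → ℝ :=
  (f.periodic_toRealFun hδ).lift

/-! ### Families of circle maps and their cyclicity -/

/-- The circle map `F_{r,a} : x ↦ x + 2π r + a f(x) (mod 2π)`. -/
noncomputable def circleFamily (f : AddCircle (2 * π) → ℝ) (r a : ℝ) :
    AddCircle (2 * π) → AddCircle (2 * π) :=
  fun x => x + ((2 * π * r + a * f x : ℝ) : AddCircle (2 * π))

/-- `ρ` represents (modulo `1`) the rotation number of the circle map `g`: it is the translation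
number of a continuous monotone lift of `g`, the circle being rescaled to length `1` upstairs. -/
def HasRotationNumber (g : AddCircle (2 * π) → AddCircle (2 * π)) (ρ : ℝ) : Prop :=
  ∃ G : CircleDeg1Lift, Continuous G ∧
    (∀ x : ℝ, g ((2 * π * x : ℝ) : AddCircle (2 * π)) = ((2 * π * G x : ℝ) : AddCircle (2 * π))) ∧
    G.translationNumber = ρ

/-- `x` is a periodic point of `g` with an attracting (that is, asymptotically stable)
trajectory. -/
def IsAttractingPeriodicPt (g : AddCircle (2 * π) → AddCircle (2 * π))
    (x : AddCircle (2 * π)) : Prop :=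
  x ∈ Function.periodicPts g ∧
    ∀ ε > 0, ∃ η > 0, ∀ y, dist y x < η →
      (∀ n : ℕ, dist (g^[n] y) (g^[n] x) < ε) ∧
      Tendsto (fun n : ℕ => dist (g^[n] y) (g^[n] x)) atTop (𝓝 0)

/-- `N(g)`: the number of attracting periodic trajectories of `g`, possibly infinite. -/
noncomputable def numAttracting (g : AddCircle (2 * π) → AddCircle (2 * π)) : ℕ∞ :=
  Set.encard {O : Set (AddCircle (2 * π)) |
    ∃ x, IsAttractingPeriodicPt g x ∧ O = Set.range (fun n : ℕ => g^[n] x)}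

/-- `B(F, ρ)`: the upper limit, as `a₁ → 0+`, of the supremum of `N(F_{r,a})` over all `r` and all
`|a| < a₁` for which `F_{r,a}` has rotation number `ρ`. -/
noncomputable def infCyclicity (f : AddCircle (2 * π) → ℝ) (ρ : ℝ) : ℕ∞ :=
  limsup (fun a₁ : ℝ => ⨆ (r : ℝ) (a : ℝ)
    (_ : HasRotationNumber (circleFamily f r a) ρ ∧ |a| < a₁), numAttracting (circleFamily f r a))
    (𝓝[>] (0 : ℝ))

/-- The infinitesimal cyclicity of the family of `f` is essentially bounded by `N`: it is at most
`N` at all rotation numbers `p/q`, in lowest terms, of sufficiently large period `q`. -/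
def EssentiallyBoundedCyclicity (N : ℕ) (f : AddCircle (2 * π) → ℝ) : Prop :=
  ∃ Q : ℕ, ∀ p q : ℕ, 0 < q → Q ≤ q → p.Coprime q → infCyclicity f ((p : ℝ) / q) ≤ N

/-- The set `IC^e_N(C^ω_δ(S))`. -/
def essentialIC (N : ℕ) {δ : ℝ} (hδ : 0 < δ) : Set (AnalyticCircleSpace δ) :=
  {f | EssentiallyBoundedCyclicity N (f.toCircleFun hδ)}

/-! ### Haar null sets -/

/-- A Borel set `E` is Haar null if some Borel probability measure vanishes on all its
translates. -/
def IsHaarNull {X : Type*} [NormedAddCommGroup X] [MeasurableSpace X] [BorelSpace X]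
    (E : Set X) : Prop :=
  MeasurableSet E ∧ ∃ μ : Measure X, IsProbabilityMeasure μ ∧
    ∀ x : X, μ ((fun y => x + y) '' E) = 0

/-- A set is Haar prevalent if its complement is Haar null. -/
def IsHaarPrevalent {X : Type*} [NormedAddCommGroup X] [MeasurableSpace X] [BorelSpace X]
    (P : Set X) : Prop :=
  IsHaarNull Pᶜ

/-! On the circle of length 1 the family reads `x + r + b φ(x)` with `b = a / (2π)`. Write `r = p/q
+ b s`. The `q`-th iterate minus `p` is then `x + b · displacement`, and as `b → 0` the displacement
tends to `q s + ∑_{i<q} φ(x + i p/q)`. Averaging along the rotation kills every Fourier mode whose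
order is not divisible by `q`. Up to a constant there remain the modes `±q`, which form one cosine
of frequency `q`, and the modes of order at least `2q`. If the coefficient `c_q` dominates a
weighted tail of the latter, the displacement is `C²` close to that cosine modulo constants, so it
crosses zero downwards at most once in each interval of length `1/q`. An attracting orbit of
rotation number `p/q` already has `q` points on the circle and uses all these places, so there is at
most one (`exists_forall_sinks_same_orbit`, `infCyclicity_le_one_of_coeffTail_le`).

Holomorphy in the strip makes the tail `O(e^{-7δq/4})`. It is therefore enough that eventually
`|c_q| ≥ e^{-5δq/4} / (q+1)²` (`mem_essentialIC_of_eventually_le`). The probe is a function with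
`c_q = e^{-5δq/4}` exactly: the rate exceeds `δ`, so it belongs to the space, and is below `7δ/4`,
so it beats the tail. For fixed `f`, the bad parameters `t` of `t • probe - f` at order `q` lie in
an interval of length `2/(q+1)²`, and Borel–Cantelli shows that almost every `t` is good
(`ae_smul_probe_sub_mem`).

Measurability rests on `TwoSinks`, which is stated by strict inequalities between finitely many
iterates and so is open in `f`. For analytic maps it is equivalent, up to an integer shift of `r`,
to having two attracting orbits of rotation number `p/q` (`exists_twoSinks_iff`). -/

/-! ### Coordinates on the circle -/

/-- The covering of the circle of length `2π` by the line, with period `1`. -/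
noncomputable def circleProj (x : ℝ) : AddCircle (2 * π) := ((2 * π * x : ℝ) : AddCircle (2 * π))

theorem circleProj_surjective : Function.Surjective circleProj := by
  intro x
  obtain ⟨y, rfl⟩ := QuotientAddGroup.mk_surjective x
  refine ⟨y / (2 * π), ?_⟩
  unfold circleProj
  congr 1
  field_simp

theorem circleProj_eq_iff {x y : ℝ} : circleProj x = circleProj y ↔ ∃ k : ℤ, x + k = y := by
  have hπ := Real.pi_pos
  unfold circleProj
  rw [eq_comm, ← sub_eq_zero, ← AddCircle.coe_sub, AddCircle.coe_eq_zero_iff]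
  refine exists_congr fun k => ?_
  rw [zsmul_eq_mul]
  constructor
  · intro h
    have : 2 * π * (x + k - y) = 0 := by linear_combination h
    have := (mul_eq_zero.1 this).resolve_left (by positivity)
    linarith
  · intro h
    rw [← h]; ring

theorem circleProj_sub (x y : ℝ) : circleProj x - circleProj y = circleProj (x - y) := by
  unfold circleProj
  rw [mul_sub, AddCircle.coe_sub]

theorem circleProj_neg (x : ℝ) : circleProj (-x) = -circleProj x := by
  unfold circleProj
  rw [mul_neg, AddCircle.coe_neg]

theorem norm_circleProj_of_abs_le {x : ℝ} (hx : |x| ≤ 1 / 2) : ‖circleProj x‖ = 2 * π * |x| := by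
  have hπ := Real.pi_pos
  unfold circleProj
  rw [(AddCircle.norm_coe_eq_abs_iff (2 * π) (by positivity)).2, abs_mul, abs_of_pos (by positivity : 0 < 2 * π)]
  rw [abs_mul, abs_of_pos (by positivity : 0 < 2 * π)]
  nlinarith

theorem norm_circleProj_le (x : ℝ) : ‖circleProj x‖ ≤ 2 * π * |x| := by
  have hπ := Real.pi_pos
  rcases le_total |x| (1 / 2) with h | h
  · exact (norm_circleProj_of_abs_le h).le
  · refine (AddCircle.norm_le_half_period (2 * π) (by positivity)).trans ?_
    rw [abs_of_pos (by positivity : 0 < 2 * π)]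
    nlinarith

/-! ### One-dimensional dynamics near a fixed point -/

/-- A fixed point on the line whose image on the circle is asymptotically stable is approached by
points that are moved towards it. -/
theorem exists_map_lt_of_stable {S : ℝ → ℝ} (hc : ContinuousAt S 0) (h0 : S 0 = 0)
    (hs : ∀ ε > 0, ∃ η > 0, ∀ t, |t| < η → (∀ n : ℕ, ‖circleProj (S^[n] t)‖ < ε) ∧
      Tendsto (fun n : ℕ => ‖circleProj (S^[n] t)‖) atTop (𝓝 0)) {ε : ℝ} (hε : 0 < ε) :
    ∃ t, 0 < t ∧ t < ε ∧ S t < t := by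
  by_contra! hcon
  have hπ := Real.pi_pos
  have h1 : ∀ᶠ t in 𝓝 (0 : ℝ), S t < 1 / 2 := by
    refine hc.eventually (gt_mem_nhds ?_)
    rw [h0]; norm_num
  obtain ⟨e, he, hes⟩ := Metric.eventually_nhds_iff.1 h1
  -- Below `e` one step stays under `1/2`, where the circle norm is `2π|x|`. An orbit close to `0`
  -- on the circle therefore cannot jump to another integer on the line.
  set e' := min e (min ε (1 / 4)) with he'
  have he'0 : 0 < e' := by positivity
  have he'1 : e' ≤ e := min_le_left _ _
  have he'2 : e' ≤ ε := (min_le_right _ _).trans (min_le_left _ _)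
  have he'3 : e' ≤ 1 / 4 := (min_le_right _ _).trans (min_le_right _ _)
  obtain ⟨η, hη, hst⟩ := hs (2 * π * e') (by positivity)
  set t := min η e' / 2 with ht
  have ht0 : 0 < t := by positivity
  have ht1 : t < η := by have := min_le_left η e'; linarith
  have ht2 : t < e' := by have := min_le_right η e'; linarith
  obtain ⟨hb, hlim⟩ := hst t (by rwa [abs_of_pos ht0])
  have key : ∀ n : ℕ, t ≤ S^[n] t ∧ S^[n] t < e' := by
    intro n
    induction n with
    | zero => exact ⟨le_rfl, ht2⟩
    | succ n ih =>
      have h2 := hb (n + 1)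
      rw [Function.iterate_succ_apply'] at h2 ⊢
      have hpos : 0 < S^[n] t := by linarith [ih.1]
      have h3 := hcon _ hpos (by linarith [ih.2])
      have h4 : S (S^[n] t) < 1 / 2 := hes (by
        rw [Real.dist_eq, sub_zero, abs_of_pos hpos]; linarith [ih.2])
      have h5 : 0 < S (S^[n] t) := by linarith
      rw [norm_circleProj_of_abs_le (by rw [abs_of_pos h5]; linarith), abs_of_pos h5] at h2
      exact ⟨by linarith [ih.1], lt_of_mul_lt_mul_left h2 (by positivity)⟩
  have hge : ∀ n : ℕ, 2 * π * t ≤ ‖circleProj (S^[n] t)‖ := by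
    intro n
    obtain ⟨h3, h4⟩ := key n
    have h5 : 0 < S^[n] t := by linarith
    rw [norm_circleProj_of_abs_le (by rw [abs_of_pos h5]; linarith), abs_of_pos h5]
    gcongr
  have := ge_of_tendsto' hlim hge
  have : 0 < 2 * π * t := by positivity
  linarith

theorem tendsto_iterate_of_map_lt {S : ℝ → ℝ} (hm : Monotone S) (hc : Continuous S) (h0 : S 0 = 0)
    {ε : ℝ} (h : ∀ t, 0 < t → t < ε → S t < t) {t : ℝ} (ht0 : 0 ≤ t) (ht : t < ε) :
    (∀ n : ℕ, S^[n] t ∈ Set.Icc 0 t) ∧ Tendsto (fun n : ℕ => S^[n] t) atTop (𝓝 0) := by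
  have hle : ∀ s, 0 ≤ s → s < ε → S s ≤ s := by
    intro s hs hs'
    rcases hs.eq_or_lt with rfl | hs
    · exact h0.le
    · exact (h s hs hs').le
  have hmem : ∀ n : ℕ, S^[n] t ∈ Set.Icc 0 t := by
    intro n
    induction n with
    | zero => exact ⟨ht0, le_rfl⟩
    | succ n ih =>
      rw [Function.iterate_succ_apply']
      exact ⟨h0 ▸ hm ih.1, (hle _ ih.1 (by linarith [ih.2])).trans ih.2⟩
  refine ⟨hmem, ?_⟩
  have hanti : Antitone (fun n : ℕ => S^[n] t) := by
    refine antitone_nat_of_succ_le fun n => ?_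
    rw [Function.iterate_succ_apply']
    exact hle _ (hmem n).1 (by linarith [(hmem n).2])
  have hbdd : BddBelow (Set.range fun n : ℕ => S^[n] t) :=
    ⟨0, by rintro _ ⟨n, rfl⟩; exact (hmem n).1⟩
  have hlim := tendsto_atTop_ciInf hanti hbdd
  set l := ⨅ n : ℕ, S^[n] t
  have hfix : S l = l := isFixedPt_of_tendsto_iterate hlim hc.continuousAt
  have hl0 : 0 ≤ l := ge_of_tendsto' hlim fun n => (hmem n).1
  have hlt : l ≤ t := le_of_tendsto' hlim fun n => (hmem n).2
  have : l = 0 := by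
    by_contra hne
    have := h l (lt_of_le_of_ne hl0 (Ne.symm hne)) (by linarith)
    linarith
  rwa [this] at hlim

/-! ### Periodic points of circle maps with a lift -/

/-- The `q`-th iterate of a lift, followed by the translation by `-p`. -/
def returnMap (G : ℝ → ℝ) (p : ℤ) (q : ℕ) (y : ℝ) : ℝ := G^[q] y - p

/-- The graph of `T` crosses the diagonal downwards at `x`, in a weak sense. -/
def CrossesDown (T : ℝ → ℝ) (x : ℝ) : Prop :=
  ∀ ε > 0, (∃ y, x - ε < y ∧ y < x ∧ y < T y) ∧ ∃ z, x < z ∧ z < x + ε ∧ T z < z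

section Lift

variable {G : CircleDeg1Lift} {g : AddCircle (2 * π) → AddCircle (2 * π)}

theorem lift_iterate_add_int (G : CircleDeg1Lift) (n : ℕ) (x : ℝ) (k : ℤ) :
    G^[n] (x + k) = G^[n] x + k := by
  rw [← CircleDeg1Lift.coe_pow, CircleDeg1Lift.map_add_int]

theorem iterate_circleProj (hg : ∀ x, g (circleProj x) = circleProj (G x)) (n : ℕ) (x : ℝ) :
    g^[n] (circleProj x) = circleProj (G^[n] x) := by
  induction n with
  | zero => rfl
  | succ n ih => rw [Function.iterate_succ_apply', ih, hg, Function.iterate_succ_apply']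

theorem returnMap_monotone (G : CircleDeg1Lift) (p : ℤ) (q : ℕ) : Monotone (returnMap G p q) :=
  fun _ _ h => sub_le_sub_right ((G.monotone.iterate q) h) _

theorem returnMap_continuous (hc : Continuous G) (p : ℤ) (q : ℕ) :
    Continuous (returnMap G p q) := (hc.iterate q).sub continuous_const

theorem iterate_returnMap (G : CircleDeg1Lift) (p : ℤ) (q n : ℕ) (x : ℝ) :
    (returnMap G p q)^[n] x = G^[q * n] x - n * p := by
  induction n with
  | zero => simp
  | succ n ih =>
    rw [Function.iterate_succ_apply', ih, returnMap, mul_add, mul_one, Nat.add_comm (q * n) q,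
      Function.iterate_add_apply]
    have := lift_iterate_add_int G q (G^[q * n] x) (-(n * p : ℤ))
    push_cast at this ⊢
    rw [sub_eq_add_neg (G^[q * n] x), this]
    ring

theorem circleProj_iterate_returnMap (G : CircleDeg1Lift) (p : ℤ) (q n : ℕ) (x : ℝ) :
    circleProj ((returnMap G p q)^[n] x) = circleProj (G^[q * n] x) := by
  rw [iterate_returnMap, circleProj_eq_iff]
  exact ⟨n * p, by push_cast; ring⟩

/-- Conjugation by `t ↦ x + σ t` with `σ = ±1` carries either side of `x` to the right of `0`, so
one-sided lemmas at `0` serve both sides. -/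
theorem iterate_reflect {T : ℝ → ℝ} {σ : ℝ} (hσ : σ * σ = 1) (x t : ℝ) (n : ℕ) :
    (fun t => σ * (T (x + σ * t) - x))^[n] t = σ * (T^[n] (x + σ * t) - x) := by
  induction n with
  | zero => simp [← mul_assoc, hσ]
  | succ n ih =>
    rw [Function.iterate_succ_apply', ih, Function.iterate_succ_apply']
    simp [← mul_assoc, hσ]

theorem norm_circleProj_sign_mul {σ : ℝ} (hσ : σ = 1 ∨ σ = -1) (x : ℝ) :
    ‖circleProj (σ * x)‖ = ‖circleProj x‖ := by
  rcases hσ with rfl | rfl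
  · rw [one_mul]
  · rw [neg_one_mul, circleProj_neg, norm_neg]

theorem norm_iterate_reflect (hg : ∀ x, g (circleProj x) = circleProj (G x)) {p : ℤ} {q : ℕ}
    {x : ℝ} (hx : returnMap G p q x = x) {σ : ℝ} (hσ : σ = 1 ∨ σ = -1) (t : ℝ) (n : ℕ) :
    ‖circleProj ((fun t => σ * (returnMap G p q (x + σ * t) - x))^[n] t)‖ =
      dist (g^[q * n] (circleProj (x + σ * t))) (g^[q * n] (circleProj x)) := by
  have hσ2 : σ * σ = 1 := by rcases hσ with rfl | rfl <;> norm_num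
  rw [iterate_reflect hσ2, norm_circleProj_sign_mul hσ, dist_eq_norm, iterate_circleProj hg,
    iterate_circleProj hg, ← circleProj_iterate_returnMap G p, ← circleProj_iterate_returnMap G p,
    circleProj_sub, (show Function.IsFixedPt (returnMap G p q) x from hx).iterate n]

theorem exists_reflect_lt_of_attracting (hc : Continuous G)
    (hg : ∀ x, g (circleProj x) = circleProj (G x)) {p : ℤ} {q : ℕ} (hq : 0 < q) {x : ℝ}
    (hx : returnMap G p q x = x) (hatt : IsAttractingPeriodicPt g (circleProj x))
    {σ : ℝ} (hσ : σ = 1 ∨ σ = -1) {ε : ℝ} (hε : 0 < ε) :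
    ∃ t, 0 < t ∧ t < ε ∧ σ * (returnMap G p q (x + σ * t) - x) < t := by
  have hT := returnMap_continuous hc p q
  have hπ := Real.pi_pos
  refine exists_map_lt_of_stable (S := fun t => σ * (returnMap G p q (x + σ * t) - x))
    (by fun_prop) (by simp [hx]) ?_ hε
  intro e he
  obtain ⟨η, hη, h⟩ := hatt.2 e he
  refine ⟨η / (2 * π), by positivity, fun t ht => ?_⟩
  have hd : dist (circleProj (x + σ * t)) (circleProj x) < η := by
    rw [dist_eq_norm, circleProj_sub, add_sub_cancel_left, norm_circleProj_sign_mul hσ]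
    refine (norm_circleProj_le t).trans_lt ?_
    rwa [lt_div_iff₀' (by positivity)] at ht
  obtain ⟨h1, h2⟩ := h _ hd
  simp only [norm_iterate_reflect hg hx hσ]
  exact ⟨fun n => h1 _, h2.comp (tendsto_id.const_mul_atTop' hq)⟩

theorem crossesDown_of_attracting (hc : Continuous G)
    (hg : ∀ x, g (circleProj x) = circleProj (G x)) {p : ℤ} {q : ℕ} (hq : 0 < q) {x : ℝ}
    (hx : returnMap G p q x = x) (hatt : IsAttractingPeriodicPt g (circleProj x)) :
    CrossesDown (returnMap G p q) x := by
  intro ε hε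
  constructor
  · obtain ⟨t, h0, h1, h2⟩ := exists_reflect_lt_of_attracting hc hg hq hx hatt (Or.inr rfl) hε
    refine ⟨x + -1 * t, by linarith, by linarith, by linarith⟩
  · obtain ⟨t, h0, h1, h2⟩ := exists_reflect_lt_of_attracting hc hg hq hx hatt (Or.inl rfl) hε
    refine ⟨x + 1 * t, by linarith, by linarith, by linarith⟩

theorem tendsto_iterate_returnMap (hc : Continuous G) {p : ℤ} {q : ℕ} {x : ℝ}
    (hx : returnMap G p q x = x) {ε : ℝ}
    (hl : ∀ y, x - ε < y → y < x → y < returnMap G p q y)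
    (hr : ∀ y, x < y → y < x + ε → returnMap G p q y < y) {y : ℝ} (hy : |y - x| < ε) :
    (∀ n : ℕ, |(returnMap G p q)^[n] y - x| ≤ |y - x|) ∧
      Tendsto (fun n : ℕ => (returnMap G p q)^[n] y) atTop (𝓝 x) := by
  have hT := returnMap_continuous hc p q
  have hm := returnMap_monotone G p q
  obtain ⟨σ, hσ, hyσ⟩ : ∃ σ : ℝ, (σ = 1 ∨ σ = -1) ∧ y = x + σ * |y - x| := by
    rcases le_total 0 (y - x) with h | h
    · exact ⟨1, Or.inl rfl, by rw [abs_of_nonneg h]; ring⟩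
    · exact ⟨-1, Or.inr rfl, by rw [abs_of_nonpos h]; ring⟩
  have hσ2 : σ * σ = 1 := by rcases hσ with rfl | rfl <;> norm_num
  have hσa : |σ| = 1 := by rcases hσ with rfl | rfl <;> norm_num
  have main := tendsto_iterate_of_map_lt (S := fun t => σ * (returnMap G p q (x + σ * t) - x))
    (ε := ε) (by
      rcases hσ with rfl | rfl
      · intro a b hab
        simp only [one_mul]
        exact sub_le_sub_right (hm (by linarith)) _
      · intro a b hab
        have := hm (show x + -1 * b ≤ x + -1 * a by linarith)
        simp only
        linarith) (by fun_prop) (by simp [hx]) (by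
      intro t h0 h1
      rcases hσ with rfl | rfl
      · have := hr (x + 1 * t) (by linarith) (by linarith)
        linarith
      · have := hl (x + -1 * t) (by linarith) (by linarith)
        linarith) (abs_nonneg (y - x)) hy
  simp only [iterate_reflect hσ2, ← hyσ] at main
  constructor
  · intro n
    have h1 := (main.1 n).2
    have h2 := (main.1 n).1
    calc |(returnMap G p q)^[n] y - x| = |σ * ((returnMap G p q)^[n] y - x)| := by
          rw [abs_mul, hσa, one_mul]
      _ ≤ |y - x| := by rwa [abs_of_nonneg h2]
  · have h3 := (main.2.const_mul σ).add_const x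
    simp only [← mul_assoc, hσ2, one_mul, sub_add_cancel, mul_zero, zero_add] at h3
    exact h3

theorem attracting_of_crossing (hc : Continuous G)
    (hg : ∀ x, g (circleProj x) = circleProj (G x)) {p : ℤ} {q : ℕ} (hq : 0 < q) {x : ℝ}
    (hx : returnMap G p q x = x) {ε : ℝ} (hε : 0 < ε)
    (hl : ∀ y, x - ε < y → y < x → y < returnMap G p q y)
    (hr : ∀ y, x < y → y < x + ε → returnMap G p q y < y) :
    IsAttractingPeriodicPt g (circleProj x) := by
  have hπ := Real.pi_pos
  constructor
  · refine ⟨q, hq, ?_⟩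
    rw [Function.IsPeriodicPt, Function.IsFixedPt, iterate_circleProj hg, eq_comm, circleProj_eq_iff]
    refine ⟨p, ?_⟩
    rw [returnMap] at hx
    linarith
  -- Closeness of the first `q` images controls the whole orbit.
  have hclose : ∀ e > 0, ∃ η > 0, ∀ w, |w - x| < η → ∀ j < q,
      dist (g^[j] (circleProj w)) (g^[j] (circleProj x)) < e := by
    intro e he
    have h1 : ∀ᶠ w in 𝓝 x, ∀ j ∈ Finset.range q, |G^[j] w - G^[j] x| < e / (2 * π) := by
      rw [Filter.eventually_all_finset]
      intro j _
      have h2 : Tendsto (fun w => |G^[j] w - G^[j] x|) (𝓝 x) (𝓝 0) := by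
        have := (((hc.iterate j).sub (continuous_const (y := G^[j] x))).abs).tendsto x
        simpa using this
      exact h2.eventually (gt_mem_nhds (by positivity))
    obtain ⟨η, hη, h2⟩ := Metric.eventually_nhds_iff.1 h1
    refine ⟨η, hη, fun w hw j hj => ?_⟩
    have h3 := h2 (by rwa [Real.dist_eq]) j (Finset.mem_range.2 hj)
    rw [dist_eq_norm, iterate_circleProj hg, iterate_circleProj hg, circleProj_sub]
    refine (norm_circleProj_le _).trans_lt ?_
    rwa [lt_div_iff₀' (by positivity)] at h3
  -- Division of `n` by `q`: the quotient counts returns, which contract to `x`, and the remainder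
  -- is one of the first `q` images.
  have hsplit : ∀ (w : ℝ) (n : ℕ), dist (g^[n] (circleProj w)) (g^[n] (circleProj x)) =
      dist (g^[n % q] (circleProj ((returnMap G p q)^[n / q] w))) (g^[n % q] (circleProj x)) := by
    intro w n
    have h1 : ∀ v, g^[n] (circleProj v) =
        g^[n % q] (circleProj ((returnMap G p q)^[n / q] v)) := by
      intro v
      rw [circleProj_iterate_returnMap, ← iterate_circleProj hg, ← Function.iterate_add_apply,
        Nat.mod_add_div]
    rw [h1 w, h1 x, (show Function.IsFixedPt (returnMap G p q) x from hx).iterate (n / q)]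
  intro e he
  obtain ⟨η, hη, h1⟩ := hclose e he
  have hη' : 0 < min (min η ε) (1 / 2) := by positivity
  refine ⟨2 * π * min (min η ε) (1 / 2), by positivity, fun y hy => ?_⟩
  -- Rounding selects the lift of `y` within `1/2` of `x`, for which distances on the line and on
  -- the circle are proportional.
  obtain ⟨w, rfl, hw⟩ : ∃ w, circleProj w = y ∧ |w - x| < min (min η ε) (1 / 2) := by
    obtain ⟨v, rfl⟩ := circleProj_surjective y
    refine ⟨v - round (v - x), circleProj_eq_iff.2 ⟨round (v - x), by ring⟩, ?_⟩
    have h2 : circleProj (v - x) = circleProj (v - round (v - x) - x) :=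
      circleProj_eq_iff.2 ⟨-round (v - x), by push_cast; ring⟩
    have h3 : |v - round (v - x) - x| ≤ 1 / 2 := by
      have := abs_sub_round (v - x)
      rwa [show v - x - round (v - x) = v - round (v - x) - x by ring] at this
    rw [dist_eq_norm, circleProj_sub, h2, norm_circleProj_of_abs_le h3] at hy
    exact lt_of_mul_lt_mul_left hy (by positivity)
  have hwη : |w - x| < η := hw.trans_le ((min_le_left _ _).trans (min_le_left _ _))
  have hwε : |w - x| < ε := hw.trans_le ((min_le_left _ _).trans (min_le_right _ _))
  obtain ⟨h2, h3⟩ := tendsto_iterate_returnMap hc hx hl hr hwε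
  constructor
  · intro n
    rw [hsplit]
    exact h1 _ ((h2 _).trans_lt hwη) _ (Nat.mod_lt _ hq)
  · rw [Metric.tendsto_atTop]
    intro e' he'
    obtain ⟨η', hη', h4⟩ := hclose e' he'
    obtain ⟨N, hN⟩ := Metric.tendsto_atTop.1 h3 η' hη'
    refine ⟨N * q, fun n hn => ?_⟩
    rw [Real.dist_eq, sub_zero, abs_of_nonneg dist_nonneg, hsplit]
    refine h4 _ ?_ _ (Nat.mod_lt _ hq)
    rw [← Real.dist_eq]
    exact hN _ ((Nat.le_div_iff_mul_le hq).2 hn)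

/-- If `G^m x = x + k`, the translation number gives `k/m = p/q`, hence `(G^q)^m x = x + m p`. For a
monotone degree-one map this forces `G^q x = x + p`. -/
theorem lift_iterate_eq_of_periodic (hg : ∀ x, g (circleProj x) = circleProj (G x)) {p : ℤ} {q : ℕ}
    (hq : 0 < q) (hτ : G.translationNumber = p / q) {x : ℝ}
    (hx : circleProj x ∈ Function.periodicPts g) : returnMap G p q x = x := by
  obtain ⟨m, hm, hper⟩ := hx
  rw [Function.IsPeriodicPt, Function.IsFixedPt, iterate_circleProj hg, eq_comm,
    circleProj_eq_iff] at hper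
  obtain ⟨k, hk⟩ := hper
  have h1 := G.translationNumber_of_map_pow_eq_add_int (x := x) (n := m) (m := k)
    (by rw [CircleDeg1Lift.coe_pow, hk]) hm
  have hm' : (m : ℝ) ≠ 0 := by positivity
  have hq' : (q : ℝ) ≠ 0 := by positivity
  rw [hτ, div_eq_div_iff hq' hm'] at h1
  have h2 := (G ^ q).iterate_pos_eq_iff (x := x) (m := p) hm
  have h3 : (G ^ q) x = x + p := by
    rw [← h2, CircleDeg1Lift.coe_pow, ← Function.iterate_mul, mul_comm q m, Function.iterate_mul]
    have h4 := (G ^ m).iterate_eq_of_map_eq_add_int (x := x) (m := k)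
      (by rw [CircleDeg1Lift.coe_pow, hk]) q
    rw [CircleDeg1Lift.coe_pow] at h4
    rw [h4]
    linarith
  rw [CircleDeg1Lift.coe_pow] at h3
  rw [returnMap, h3]
  ring

/-- An earlier return would make the translation number a fraction with denominator less than `q`,
contrary to `p/q` being in lowest terms. -/
theorem eq_of_iterate_eq_add_int {p : ℤ} {q : ℕ} (hq : 0 < q) (hpq : IsCoprime p (q : ℤ))
    (hτ : G.translationNumber = p / q) {x : ℝ} {i j : ℕ} (hi : i < q) (hj : j < q) {k : ℤ}
    (h : G^[i] x + k = G^[j] x) : i = j := by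
  wlog hij : i ≤ j generalizing i j k
  · exact (this hj hi (k := -k) (by rw [← h]; push_cast; ring) (by omega)).symm
  by_contra hne
  obtain ⟨m, rfl⟩ := Nat.exists_eq_add_of_le hij
  have hm : 0 < m := by omega
  rw [add_comm i m, Function.iterate_add_apply] at h
  have h1 := G.translationNumber_of_map_pow_eq_add_int (x := G^[i] x) (n := m) (m := k)
    (by rw [CircleDeg1Lift.coe_pow, h]) hm
  have hm' : (m : ℝ) ≠ 0 := by positivity
  have hq' : (q : ℝ) ≠ 0 := by positivity
  rw [hτ, div_eq_div_iff hq' hm'] at h1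
  have h2 : p * m = k * q := by exact_mod_cast h1
  have h3 : (q : ℤ) ∣ m := hpq.symm.dvd_of_dvd_mul_left ⟨k, by rw [h2]; ring⟩
  have h4 := Nat.le_of_dvd hm (Int.natCast_dvd_natCast.1 h3)
  omega

/-- `G^j` is increasing, continuous and commutes with the return map, so it transports the
witnesses. -/
theorem CrossesDown.iterate (hc : Continuous G) (hs : StrictMono G) {p : ℤ} {q : ℕ} {x : ℝ}
    (h : CrossesDown (returnMap G p q) x) (j : ℕ) : CrossesDown (returnMap G p q) (G^[j] x) := by
  have hsj := hs.iterate j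
  have hcomm : ∀ y, returnMap G p q (G^[j] y) = G^[j] (returnMap G p q y) := by
    intro y
    have := lift_iterate_add_int G j (G^[q] y) (-p)
    push_cast at this
    rw [returnMap, returnMap, sub_eq_add_neg (G^[q] y), this, ← Function.iterate_add_apply,
      ← Function.iterate_add_apply, add_comm q j, sub_eq_add_neg]
  intro ε hε
  obtain ⟨η, hη, hcl⟩ := Metric.continuous_iff.1 (hc.iterate j) x ε hε
  obtain ⟨⟨y, hy1, hy2, hy3⟩, z, hz1, hz2, hz3⟩ := h η hη
  constructor
  · have h1 := hcl y (by rw [Real.dist_eq, abs_lt]; constructor <;> linarith)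
    rw [Real.dist_eq, abs_lt] at h1
    exact ⟨G^[j] y, by linarith [h1.1], hsj hy2, by rw [hcomm]; exact hsj hy3⟩
  · have h1 := hcl z (by rw [Real.dist_eq, abs_lt]; constructor <;> linarith)
    rw [Real.dist_eq, abs_lt] at h1
    exact ⟨G^[j] z, hsj hz1, by linarith [h1.2], by rw [hcomm]; exact hsj hz3⟩

end Lift

/-! ### Pairs of attracting orbits expressed by strict inequalities -/

theorem exists_isolated_sign_change {D : ℝ → ℝ} (hD : ∀ x, AnalyticAt ℝ D x) {y z : ℝ} (hyz : y < z)
    (hy : 0 < D y) (hz : D z < 0) :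
    ∃ x, y < x ∧ x < z ∧ D x = 0 ∧ ∃ ε > 0, (∀ w, x - ε < w → w < x → 0 < D w) ∧
      ∀ w, x < w → w < x + ε → D w < 0 := by
  have hc : Continuous D := continuous_iff_continuousAt.2 fun x => (hD x).continuousAt
  set S : Set ℝ := {t | t ∈ Set.Icc y z ∧ 0 < D t} with hS
  have hyS : y ∈ S := ⟨⟨le_rfl, hyz.le⟩, hy⟩
  have hbdd : BddAbove S := ⟨z, fun t ht => ht.1.2⟩
  have hlub : IsLUB S (sSup S) := isLUB_csSup ⟨y, hyS⟩ hbdd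
  set x := sSup S with hx
  have hyx : y ≤ x := hlub.1 hyS
  have hxz : x ≤ z := hlub.2 fun t ht => ht.1.2
  have hright : ∀ t, x < t → t ≤ z → D t ≤ 0 := by
    intro t h1 h2
    by_contra! h3
    exact absurd (hlub.1 (show t ∈ S from ⟨⟨by linarith, h2⟩, h3⟩)) (not_le.2 h1)
  have hx0 : D x = 0 := by
    apply le_antisymm
    · by_contra! h
      have hlt : x < z := lt_of_le_of_ne hxz (by rintro h'; rw [h'] at h; linarith)
      have h1 : ∀ᶠ t in 𝓝[>] x, 0 < D t :=
        (hc.continuousAt.eventually (lt_mem_nhds h)).filter_mono nhdsWithin_le_nhds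
      have h2 : ∀ᶠ t in 𝓝[>] x, t ∈ Set.Ioc x z := Ioc_mem_nhdsGT hlt
      obtain ⟨t, h3, h4⟩ := (h1.and h2).exists
      linarith [hright t h4.1 h4.2]
    · have hmem := hlub.mem_closure ⟨y, hyS⟩
      have : S ⊆ {t | 0 ≤ D t} := fun t ht => ht.2.le
      exact (closure_minimal this (isClosed_le continuous_const hc)) hmem
  have hxS : x ∉ S := fun h => by have := h.2; linarith
  have hleft : ∀ w, w < x → ∃ s ∈ S, w < s ∧ s < x := by
    intro w hw
    obtain ⟨s, hs, hws, hsx⟩ := hlub.exists_between hw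
    exact ⟨s, hs, hws, lt_of_le_of_ne hsx fun h => hxS (h ▸ hs)⟩
  have hyx' : y < x := lt_of_le_of_ne hyx fun h => by rw [← h] at hx0; linarith
  have hxz' : x < z := lt_of_le_of_ne hxz fun h => by rw [h] at hx0; linarith
  refine ⟨x, hyx', hxz', hx0, ?_⟩
  -- Points with `D > 0` accumulate at `x` from the left, so `D` does not vanish near `x` and the
  -- zero is isolated. Continuity then fixes the sign on each side.
  rcases (hD x).eventually_eq_zero_or_eventually_ne_zero with h | h
  · obtain ⟨η, hη, h1⟩ := Metric.eventually_nhds_iff.1 h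
    obtain ⟨s, hs, h2, h3⟩ := hleft (x - η) (by linarith)
    have := h1 (show dist s x < η by rw [Real.dist_eq, abs_lt]; constructor <;> linarith)
    have := hs.2
    linarith
  · rw [eventually_nhdsWithin_iff] at h
    obtain ⟨η, hη, h1⟩ := Metric.eventually_nhds_iff.1 h
    have hne : ∀ w, x - η < w → w < x + η → w ≠ x → D w ≠ 0 := fun w h2 h3 h4 =>
      h1 (show dist w x < η by rw [Real.dist_eq, abs_lt]; constructor <;> linarith) h4
    refine ⟨min η (z - x), lt_min hη (by linarith), fun w h2 h3 => ?_, fun w h2 h3 => ?_⟩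
    · have h4 := min_le_left η (z - x)
      by_contra! hneg
      obtain ⟨s, hs, h5, h6⟩ := hleft w h3
      obtain ⟨v, hv, hv0⟩ := intermediate_value_Icc h5.le hc.continuousOn
        (show (0 : ℝ) ∈ Set.Icc (D w) (D s) from ⟨hneg, hs.2.le⟩)
      exact hne v (by linarith [hv.1]) (by linarith [hv.2]) (by linarith [hv.2]) hv0
    · have h4 := min_le_left η (z - x)
      have h5 := min_le_right η (z - x)
      exact lt_of_le_of_ne (hright w h2 (by linarith)) (hne w (by linarith) (by linarith) h2.ne')

/-- Two intervals that `L ^ q - p` contracts weakly, with disjoint orbits on the circle. -/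
def TwoSinks (L : ℝ → ℝ) (p : ℤ) (q : ℕ) : Prop :=
  ∃ y₁ z₁ y₂ z₂ : ℝ, y₁ < z₁ ∧ y₂ < z₂ ∧
    (y₁ < returnMap L p q y₁ ∧ returnMap L p q z₁ < z₁) ∧
    (y₂ < returnMap L p q y₂ ∧ returnMap L p q z₂ < z₂) ∧
    ∀ j < q, ∃ k : ℤ, L^[j] z₁ + k < y₂ ∧ z₂ < L^[j] y₁ + k + 1

section Lift

variable {G : CircleDeg1Lift} {g : AddCircle (2 * π) → AddCircle (2 * π)}

theorem exists_crossesDown_of_two_attracting (hc : Continuous G)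
    (hg : ∀ x, g (circleProj x) = circleProj (G x)) {p : ℤ} {q : ℕ} (hq : 0 < q)
    (hτ : G.translationNumber = p / q) (hN : 1 < numAttracting g) :
    ∃ x₁ x₂ : ℝ, returnMap G p q x₁ = x₁ ∧ returnMap G p q x₂ = x₂ ∧
      CrossesDown (returnMap G p q) x₁ ∧ CrossesDown (returnMap G p q) x₂ ∧
      ∀ (j : ℕ) (k : ℤ), G^[j] x₁ + k ≠ x₂ := by
  obtain ⟨O₁, O₂, ⟨u₁, h₁, rfl⟩, ⟨u₂, h₂, rfl⟩, hne⟩ := Set.one_lt_encard_iff.1 hN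
  obtain ⟨x₁, rfl⟩ := circleProj_surjective u₁
  obtain ⟨x₂, rfl⟩ := circleProj_surjective u₂
  have hf₁ := lift_iterate_eq_of_periodic hg hq hτ h₁.1
  have hf₂ := lift_iterate_eq_of_periodic hg hq hτ h₂.1
  refine ⟨x₁, x₂, hf₁, hf₂, crossesDown_of_attracting hc hg hq hf₁ h₁,
    crossesDown_of_attracting hc hg hq hf₂ h₂, fun j k hjk => hne ?_⟩
  have h12 : g^[j] (circleProj x₁) = circleProj x₂ := by
    rw [iterate_circleProj hg]
    exact circleProj_eq_iff.2 ⟨k, hjk⟩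
  obtain ⟨m, hm, hper⟩ := h₁.1
  have h21 : circleProj x₁ = g^[m * j - j] (circleProj x₂) := by
    rw [← h12, ← Function.iterate_add_apply, Nat.sub_add_cancel (Nat.le_mul_of_pos_left j hm)]
    exact (hper.mul_const j).symm
  apply Set.Subset.antisymm
  · rintro _ ⟨n, rfl⟩
    refine ⟨n + (m * j - j), ?_⟩
    simp only
    rw [Function.iterate_add_apply, ← h21]
  · rintro _ ⟨n, rfl⟩
    refine ⟨n + j, ?_⟩
    simp only
    rw [Function.iterate_add_apply, h12]

/-- Since `x₂` is off the orbit of `x₁`, it lies strictly between consecutive integer translates of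
each `G^j x₁`. For the finitely many `j < q` this survives replacing both points by the ends of
small intervals around them. -/
theorem twoSinks_of_two_attracting (hc : Continuous G)
    (hg : ∀ x, g (circleProj x) = circleProj (G x)) {p : ℤ} {q : ℕ} (hq : 0 < q)
    (hτ : G.translationNumber = p / q) (hN : 1 < numAttracting g) : TwoSinks G p q := by
  obtain ⟨x₁, x₂, -, -, hs₁, hs₂, hne⟩ := exists_crossesDown_of_two_attracting hc hg hq hτ hN
  have hk : ∀ j : ℕ, ∃ k : ℤ, G^[j] x₁ + k < x₂ ∧ x₂ < G^[j] x₁ + k + 1 := by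
    intro j
    refine ⟨⌊x₂ - G^[j] x₁⌋, lt_of_le_of_ne ?_ (hne j _), ?_⟩
    · linarith [Int.floor_le (x₂ - G^[j] x₁)]
    · linarith [Int.lt_floor_add_one (x₂ - G^[j] x₁)]
  choose k hk1 hk2 using hk
  have hev : ∀ᶠ v : ℝ × ℝ in 𝓝 (x₁, x₂), ∀ j ∈ Finset.range q,
      G^[j] v.1 + k j < v.2 ∧ v.2 < G^[j] v.1 + k j + 1 := by
    rw [Filter.eventually_all_finset]
    intro j _
    have hcj : Continuous fun v : ℝ × ℝ => G^[j] v.1 := (hc.iterate j).comp continuous_fst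
    exact ((isOpen_lt (hcj.add continuous_const) continuous_snd).inter
      (isOpen_lt continuous_snd ((hcj.add continuous_const).add continuous_const))).mem_nhds
      ⟨hk1 j, hk2 j⟩
  obtain ⟨ε, hε, h⟩ := Metric.eventually_nhds_iff.1 hev
  obtain ⟨⟨y₁, a1, a2, a3⟩, z₁, b1, b2, b3⟩ := hs₁ ε hε
  obtain ⟨⟨y₂, c1, c2, c3⟩, z₂, d1, d2, d3⟩ := hs₂ ε hε
  refine ⟨y₁, z₁, y₂, z₂, by linarith, by linarith, ⟨a3, b3⟩, ⟨c3, d3⟩, fun j hj => ⟨k j, ?_, ?_⟩⟩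
  · refine (h (y := (z₁, y₂)) ?_ j (Finset.mem_range.2 hj)).1
    simp only [Prod.dist_eq, Real.dist_eq]
    apply max_lt <;> rw [abs_lt] <;> constructor <;> linarith
  · refine (h (y := (y₁, z₂)) ?_ j (Finset.mem_range.2 hj)).2
    simp only [Prod.dist_eq, Real.dist_eq]
    apply max_lt <;> rw [abs_lt] <;> constructor <;> linarith

/-- Analyticity is what turns a weakly contracted interval into an attracting point: a merely
continuous map could have a whole segment of fixed points there. If the two points shared an orbit,
the last clause of `TwoSinks` would put an integer strictly between `k` and `k + 1`. -/
theorem two_attracting_of_twoSinks (hc : Continuous G)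
    (hg : ∀ x, g (circleProj x) = circleProj (G x)) (han : ∀ x, AnalyticAt ℝ G x)
    {p : ℤ} {q : ℕ} (hq : 0 < q) (h : TwoSinks G p q) :
    G.translationNumber = p / q ∧ 1 < numAttracting g := by
  have hD : ∀ x, AnalyticAt ℝ (fun y => returnMap G p q y - y) x := by
    have hit : ∀ (n : ℕ) (x : ℝ), AnalyticAt ℝ (G^[n]) x := by
      intro n
      induction n with
      | zero => exact fun x => analyticAt_id
      | succ n ih =>
        intro x
        rw [Function.iterate_succ']
        exact (han _).comp (ih x)
    exact fun x => ((hit q x).sub analyticAt_const).sub analyticAt_id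
  obtain ⟨y₁, z₁, y₂, z₂, h₁, h₂, ⟨a1, b1⟩, ⟨a2, b2⟩, hdis⟩ := h
  obtain ⟨x₁, c1, d1, e1, ε₁, hε₁, l1, r1⟩ :=
    exists_isolated_sign_change hD h₁ (by linarith) (by linarith)
  obtain ⟨x₂, c2, d2, e2, ε₂, hε₂, l2, r2⟩ :=
    exists_isolated_sign_change hD h₂ (by linarith) (by linarith)
  simp only [sub_eq_zero, sub_pos, sub_neg] at e1 e2 l1 r1 l2 r2
  have hq' : (q : ℝ) ≠ 0 := by positivity
  constructor
  · refine G.translationNumber_of_map_pow_eq_add_int (x := x₁) ?_ hq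
    rw [CircleDeg1Lift.coe_pow]
    rw [returnMap] at e1
    linarith
  have ha₁ := attracting_of_crossing hc hg hq e1 hε₁ l1 r1
  have ha₂ := attracting_of_crossing hc hg hq e2 hε₂ l2 r2
  refine Set.one_lt_encard_iff.2 ⟨_, _, ⟨_, ha₁, rfl⟩, ⟨_, ha₂, rfl⟩, fun heq => ?_⟩
  have hmem : circleProj x₂ ∈ Set.range fun n : ℕ => g^[n] (circleProj x₁) :=
    heq ▸ ⟨0, rfl⟩
  obtain ⟨n, hn⟩ := hmem
  have hn' : g^[n % q] (circleProj x₁) = circleProj x₂ := by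
    rw [← hn]
    simp only
    conv_rhs => rw [← Nat.mod_add_div n q, Function.iterate_add_apply]
    rw [iterate_circleProj hg (q * (n / q)), ← circleProj_iterate_returnMap G p,
      (show Function.IsFixedPt (returnMap G p q) x₁ from e1).iterate (n / q)]
  rw [iterate_circleProj hg, circleProj_eq_iff] at hn'
  obtain ⟨l, hl⟩ := hn'
  obtain ⟨k, hk1, hk2⟩ := hdis (n % q) (Nat.mod_lt _ hq)
  have hm := G.monotone.iterate (n % q)
  have m1 := hm d1.le
  have m2 := hm c1.le
  have s1 : (k : ℝ) < l := by linarith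
  have s2 : (l : ℝ) < k + 1 := by linarith
  have s1' : k < l := by exact_mod_cast s1
  have s2' : l < k + 1 := by exact_mod_cast s2
  omega

end Lift

/-! ### Real functions attached to elements of the analytic space -/

section Analytic

variable {δ : ℝ} (hδ : 0 < δ) (f : AnalyticCircleSpace δ)

theorem isOpen_strip (δ : ℝ) : IsOpen (strip δ) :=
  isOpen_lt (Complex.continuous_im.abs) continuous_const

/-- A holomorphic extension of `f` from the strip to a function on the plane. -/
noncomputable def holoExt (f : AnalyticCircleSpace δ) : ℂ → ℂ := f.2.choose

theorem differentiableOn_holoExt : DifferentiableOn ℂ (holoExt f) (strip δ) := f.2.choose_spec.1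

theorem apply_eq_holoExt (z : strip δ) : f.1 z = holoExt f z := f.2.choose_spec.2.1 z

theorem holoExt_add_two_pi {z : ℂ} (hz : z ∈ strip δ) :
    holoExt f (z + ((2 * π : ℝ) : ℂ)) = holoExt f z := f.2.choose_spec.2.2.1 z hz

theorem holoExt_ofReal_im {δ : ℝ} (hδ : 0 < δ) (f : AnalyticCircleSpace δ) (x : ℝ) : (holoExt f x).im = 0 :=
  f.2.choose_spec.2.2.2 x (real_mem_strip hδ x)

theorem norm_holoExt_le {z : ℂ} (hz : z ∈ strip δ) : ‖holoExt f z‖ ≤ ‖f‖ := by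
  rw [← apply_eq_holoExt f ⟨z, hz⟩]
  exact f.1.norm_coe_le_norm _

theorem toRealFun_eq (x : ℝ) : f.toRealFun hδ x = (holoExt f x).re := by
  rw [AnalyticCircleSpace.toRealFun, apply_eq_holoExt]

theorem ofReal_toRealFun (x : ℝ) : (f.toRealFun hδ x : ℂ) = holoExt f x := by
  rw [toRealFun_eq]
  exact Complex.ext rfl (by simp [holoExt_ofReal_im hδ f x])

theorem abs_toRealFun_le (x : ℝ) : |f.toRealFun hδ x| ≤ ‖f‖ := by
  rw [toRealFun_eq]
  exact (Complex.abs_re_le_norm _).trans (norm_holoExt_le f (real_mem_strip hδ x))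

theorem analyticAt_holoExt {δ : ℝ} (hδ : 0 < δ) (f : AnalyticCircleSpace δ) (x : ℝ) : AnalyticAt ℂ (holoExt f) x :=
  (differentiableOn_holoExt f).analyticAt ((isOpen_strip δ).mem_nhds (real_mem_strip hδ x))

theorem analyticAt_toRealFun (x : ℝ) : AnalyticAt ℝ (f.toRealFun hδ) x := by
  have h1 : AnalyticAt ℝ (fun y : ℝ => (holoExt f y).re) x :=
    Complex.reCLM.analyticAt _ |>.comp
      ((analyticAt_holoExt hδ f x).restrictScalars.comp (Complex.ofRealCLM.analyticAt x))
  have h2 : (fun y : ℝ => (holoExt f y).re) = f.toRealFun hδ :=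
    funext fun y => (toRealFun_eq hδ f y).symm
  rwa [h2] at h1

theorem closedBall_subset_strip (hδ : 0 < δ) (x : ℝ) :
    Metric.closedBall (x : ℂ) (δ / 2) ⊆ strip δ := by
  intro z hz
  have h1 : |(z - x).im| ≤ δ / 2 := (Complex.abs_im_le_norm _).trans (by rwa [← dist_eq_norm])
  have h2 : (z - x).im = z.im := by simp
  rw [h2] at h1
  exact h1.trans_lt (by linarith)

/-- Cauchy's estimate on discs of radius `δ/2`. It gives an explicit range of `a` in which the lifts
are increasing. -/
theorem abs_deriv_toRealFun_le (x : ℝ) : |deriv (f.toRealFun hδ) x| ≤ 2 * ‖f‖ / δ := by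
  have hsub := closedBall_subset_strip hδ x
  have hb : ∀ z ∈ strip δ, ‖holoExt f z‖ ≤ ‖f‖ := fun z => norm_holoExt_le f
  have hd := differentiableOn_holoExt f
  have h2 : HasDerivAt (fun y : ℝ => (holoExt f y).re) (deriv (holoExt f) x).re x :=
    (analyticAt_holoExt hδ f x).differentiableAt.hasDerivAt.real_of_complex
  have h3 : (fun y : ℝ => (holoExt f y).re) = f.toRealFun hδ :=
    funext fun y => (toRealFun_eq hδ f y).symm
  rw [h3] at h2
  rw [h2.deriv]
  generalize ‖f‖ = B at hb
  generalize holoExt f = H at hb hd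
  have h1 : ‖deriv H x‖ ≤ B / (δ / 2) := by
    refine Complex.norm_deriv_le_of_forall_mem_sphere_norm_le (by positivity) ?_ ?_
    · exact (hd.mono (by rwa [closure_ball _ (by positivity)])).diffContOnCl
    · exact fun z hz => hb z (hsub (Metric.sphere_subset_closedBall hz))
  refine (Complex.abs_re_le_norm _).trans (h1.trans (le_of_eq ?_))
  field_simp

/-- The function `f` in the coordinate in which the circle has length `1`. -/
noncomputable def unitFun (x : ℝ) : ℝ := f.toRealFun hδ (2 * π * x)

theorem unitFun_add_one (x : ℝ) : unitFun hδ f (x + 1) = unitFun hδ f x := by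
  rw [unitFun, mul_add, mul_one, f.periodic_toRealFun hδ]
  rfl

theorem analyticAt_unitFun (x : ℝ) : AnalyticAt ℝ (unitFun hδ f) x :=
  (analyticAt_toRealFun hδ f (2 * π * x)).comp (f := fun x => 2 * π * x)
    (analyticAt_const.mul analyticAt_id)

theorem hasDerivAt_unitFun (x : ℝ) :
    HasDerivAt (unitFun hδ f) (deriv (f.toRealFun hδ) (2 * π * x) * (2 * π)) x := by
  have h1 := (analyticAt_toRealFun hδ f (2 * π * x)).differentiableAt.hasDerivAt
  have h2 : HasDerivAt (fun x : ℝ => 2 * π * x) (2 * π) x := by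
    simpa using (hasDerivAt_id x).const_mul (2 * π)
  exact h1.comp x h2

/-- The lift `x ↦ x + r + b φ(x)` of a circle map. -/
def liftFun (φ : ℝ → ℝ) (r b x : ℝ) : ℝ := x + r + b * φ x

theorem circleFamily_circleProj (r a x : ℝ) :
    circleFamily (f.toCircleFun hδ) r a (circleProj x) =
      circleProj (liftFun (unitFun hδ f) r (a / (2 * π)) x) := by
  have hπ := Real.pi_pos
  have h1 : f.toCircleFun hδ (circleProj x) = unitFun hδ f x := rfl
  rw [circleFamily, h1, circleProj, circleProj, ← AddCircle.coe_add, liftFun]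
  congr 1
  field_simp
  ring

theorem strictMono_liftFun (r : ℝ) {a : ℝ} (ha : |a| * (2 * ‖f‖ / δ) < 1) :
    StrictMono (liftFun (unitFun hδ f) r (a / (2 * π))) := by
  have hπ := Real.pi_pos
  have hd : ∀ x, HasDerivAt (liftFun (unitFun hδ f) r (a / (2 * π)))
      (1 + a / (2 * π) * (deriv (f.toRealFun hδ) (2 * π * x) * (2 * π))) x := fun x =>
    ((hasDerivAt_id x).add_const r).add ((hasDerivAt_unitFun hδ f x).const_mul _)
  refine strictMono_of_deriv_pos fun x => ?_
  rw [(hd x).deriv]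
  have h1 : a / (2 * π) * (deriv (f.toRealFun hδ) (2 * π * x) * (2 * π)) =
      a * deriv (f.toRealFun hδ) (2 * π * x) := by field_simp
  have h2 : |a * deriv (f.toRealFun hδ) (2 * π * x)| < 1 := by
    rw [abs_mul]
    exact (mul_le_mul_of_nonneg_left (abs_deriv_toRealFun_le hδ f _) (abs_nonneg a)).trans_lt ha
  rw [h1]
  linarith [(abs_lt.1 h2).1]

theorem continuous_unitFun : Continuous (unitFun hδ f) :=
  continuous_iff_continuousAt.2 fun x => (analyticAt_unitFun hδ f x).continuousAt

theorem analyticAt_liftFun (r b x : ℝ) : AnalyticAt ℝ (liftFun (unitFun hδ f) r b) x :=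
  (analyticAt_id.add analyticAt_const).add (analyticAt_const.mul (analyticAt_unitFun hδ f x))

/-- The lift of a member of the family, as a lift of degree one. -/
noncomputable def familyLift (r : ℝ) {a : ℝ} (ha : |a| * (2 * ‖f‖ / δ) < 1) : CircleDeg1Lift where
  toFun := liftFun (unitFun hδ f) r (a / (2 * π))
  monotone' := (strictMono_liftFun hδ f r ha).monotone
  map_add_one' x := by
    rw [liftFun, liftFun, unitFun_add_one]
    ring

/-- Two continuous lifts differ by a continuous integer-valued function, hence by a constant, which
can be absorbed in `r`. -/
theorem exists_familyLift_eq {r a : ℝ} (ha : |a| * (2 * ‖f‖ / δ) < 1) {G : CircleDeg1Lift}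
    (hc : Continuous G)
    (hG : ∀ x, circleFamily (f.toCircleFun hδ) r a (circleProj x) = circleProj (G x)) :
    ∃ m : ℤ, G = familyLift hδ f (r + m) ha := by
  set L := liftFun (unitFun hδ f) r (a / (2 * π)) with hL
  have hLc : Continuous L := by
    have := continuous_unitFun hδ f
    unfold L liftFun
    fun_prop
  have hint : ∀ x, ∃ k : ℤ, L x + k = G x := fun x => by
    rw [← circleProj_eq_iff, ← hG, circleFamily_circleProj]
  choose k hk using hint
  have hkc : Continuous k := by
    rw [Int.isClosedEmbedding_coe_real.isInducing.continuous_iff]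
    have : ((↑) : ℤ → ℝ) ∘ k = fun x => G x - L x := funext fun x => by simp [← hk x]
    rw [this]
    exact hc.sub hLc
  refine ⟨k 0, CircleDeg1Lift.ext fun x => ?_⟩
  rw [← hk x, PreconnectedSpace.constant inferInstance hkc (x := x) (y := 0)]
  show L x + k 0 = liftFun (unitFun hδ f) (r + k 0) (a / (2 * π)) x
  rw [hL, liftFun, liftFun]
  ring

theorem exists_twoSinks_iff {a : ℝ} (ha : |a| * (2 * ‖f‖ / δ) < 1) {p q : ℕ} (hq : 0 < q) :
    (∃ r, HasRotationNumber (circleFamily (f.toCircleFun hδ) r a) ((p : ℝ) / q) ∧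
      1 < numAttracting (circleFamily (f.toCircleFun hδ) r a)) ↔
    ∃ r, TwoSinks (liftFun (unitFun hδ f) r (a / (2 * π))) p q := by
  constructor
  · rintro ⟨r, ⟨G, hc, hG, hτ⟩, hN⟩
    obtain ⟨m, rfl⟩ := exists_familyLift_eq hδ f ha hc hG
    exact ⟨r + m, twoSinks_of_two_attracting (p := p) hc hG hq (by simpa using hτ) hN⟩
  · rintro ⟨r, h⟩
    have hG := circleFamily_circleProj hδ f r a
    have han := analyticAt_liftFun hδ f r (a / (2 * π))
    have hc : Continuous (familyLift hδ f r ha) :=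
      continuous_iff_continuousAt.2 fun x => (han x).continuousAt
    obtain ⟨hτ, hN⟩ := two_attracting_of_twoSinks (G := familyLift hδ f r ha) hc hG han hq h
    exact ⟨r, ⟨_, hc, hG, by simpa using hτ⟩, hN⟩

end Analytic

/-! ### The set of functions with cyclicity at most one is Borel -/

theorem infCyclicity_le_one_iff (φ : AddCircle (2 * π) → ℝ) (ρ : ℝ) :
    infCyclicity φ ρ ≤ 1 ↔ ∃ a₁ > 0, ∀ r a : ℝ, |a| < a₁ →
      HasRotationNumber (circleFamily φ r a) ρ → ¬ 1 < numAttracting (circleFamily φ r a) := by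
  unfold infCyclicity
  constructor
  · intro h
    -- The count takes values in `ℕ∞`, so `≤ 1` can be traded for the strict bound `< 2`, which
    -- holds eventually.
    have h2 := eventually_lt_of_limsup_lt (h.trans_lt (show (1 : ℕ∞) < 2 by norm_num))
    obtain ⟨a₁, ha, ha₁⟩ := (h2.and self_mem_nhdsWithin).exists
    refine ⟨a₁, ha₁, fun r a hra hrot hN => ?_⟩
    have h4 : numAttracting (circleFamily φ r a) < 2 := by
      refine lt_of_le_of_lt ?_ ha
      exact le_iSup₂_of_le r a (le_iSup_of_le ⟨hrot, hra⟩ le_rfl)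
    exact absurd (Order.add_one_le_of_lt hN) (not_le.2 (by simpa [one_add_one_eq_two] using h4))
  · rintro ⟨a₁, ha₁, h⟩
    refine limsup_le_of_le (by isBoundedDefault) ?_
    filter_upwards [Ioo_mem_nhdsGT ha₁] with a' ha'
    exact iSup_le fun r => iSup_le fun a => iSup_le fun hra =>
      not_lt.1 (h r a (hra.2.trans ha'.2) hra.1)

section Borel

variable {δ : ℝ} (hδ : 0 < δ)

/-- Thresholds `a₁ = 1/n` suffice, which makes the outer quantifier countable. The condition `2‖f‖/δ
< n` is open in `f` and ensures monotone lifts whenever `|a| n < 1`. -/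
theorem infCyclicity_le_one_iff_exists_nat (f : AnalyticCircleSpace δ) {p q : ℕ} (hq : 0 < q) :
    infCyclicity (f.toCircleFun hδ) ((p : ℝ) / q) ≤ 1 ↔ ∃ n : ℕ, 2 * ‖f‖ / δ < n ∧
      ¬ ∃ r a : ℝ, |a| * n < 1 ∧ TwoSinks (liftFun (unitFun hδ f) r (a / (2 * π))) p q := by
  have hsmall : ∀ {n : ℕ} {a : ℝ}, 2 * ‖f‖ / δ < n → |a| * n < 1 → |a| * (2 * ‖f‖ / δ) < 1 :=
    fun hn ha => (mul_le_mul_of_nonneg_left hn.le (abs_nonneg _)).trans_lt ha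
  rw [infCyclicity_le_one_iff]
  constructor
  · rintro ⟨a₁, ha₁, h⟩
    obtain ⟨n, hn⟩ := exists_nat_gt (max (2 * ‖f‖ / δ) (1 / a₁))
    have hn1 := (le_max_left _ _).trans_lt hn
    have hn2 := (le_max_right _ _).trans_lt hn
    refine ⟨n, hn1, ?_⟩
    rintro ⟨r, a, ha, hs⟩
    obtain ⟨r', hrot, hN⟩ := (exists_twoSinks_iff hδ f (hsmall hn1 ha) hq).2 ⟨r, hs⟩
    refine h r' a ?_ hrot hN
    rw [div_lt_iff₀ ha₁] at hn2
    have hn0 : (0 : ℝ) < n := by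
      by_contra! hneg
      nlinarith
    by_contra! hle
    nlinarith
  · rintro ⟨n, hn, h⟩
    have hn0 : (0 : ℝ) < n := (by positivity : (0 : ℝ) ≤ 2 * ‖f‖ / δ).trans_lt hn
    refine ⟨1 / n, by positivity, fun r a ha hrot hN => h ?_⟩
    rw [lt_div_iff₀ hn0] at ha
    obtain ⟨r', hs⟩ := (exists_twoSinks_iff hδ f (hsmall hn ha) hq).1 ⟨r, hrot, hN⟩
    exact ⟨r', a, ha, hs⟩

theorem continuous_iterate_liftFun (r b y : ℝ) (j : ℕ) :
    Continuous fun f : AnalyticCircleSpace δ => (liftFun (unitFun hδ f) r b)^[j] y := by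
  induction j with
  | zero => exact continuous_const
  | succ j ih =>
    simp only [Function.iterate_succ_apply']
    have h1 : Continuous fun f : AnalyticCircleSpace δ =>
        unitFun hδ f ((liftFun (unitFun hδ f) r b)^[j] y) := by
      unfold unitFun AnalyticCircleSpace.toRealFun
      refine Complex.continuous_re.comp (continuous_subtype_val.eval ?_)
      exact Continuous.subtype_mk (Complex.continuous_ofReal.comp (continuous_const.mul ih)) _
    exact (ih.add continuous_const).add (continuous_const.mul h1)

theorem isOpen_setOf_twoSinks (r b : ℝ) (p : ℤ) (q : ℕ) :
    IsOpen {f : AnalyticCircleSpace δ | TwoSinks (liftFun (unitFun hδ f) r b) p q} := by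
  have hc := continuous_iterate_liftFun hδ r b
  have hT : ∀ y, Continuous fun f : AnalyticCircleSpace δ =>
      returnMap (liftFun (unitFun hδ f) r b) p q y := fun y => (hc y q).sub continuous_const
  unfold TwoSinks
  simp only [Set.ofPred_exists, Set.ofPred_and]
  refine isOpen_iUnion fun y₁ => isOpen_iUnion fun z₁ => isOpen_iUnion fun y₂ =>
    isOpen_iUnion fun z₂ => isOpen_const.inter (isOpen_const.inter
      (((isOpen_lt continuous_const (hT _)).inter (isOpen_lt (hT _) continuous_const)).inter
      (((isOpen_lt continuous_const (hT _)).inter (isOpen_lt (hT _) continuous_const)).inter ?_)))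
  have : {f : AnalyticCircleSpace δ | ∀ j < q, ∃ k : ℤ,
      (liftFun (unitFun hδ f) r b)^[j] z₁ + k < y₂ ∧
        z₂ < (liftFun (unitFun hδ f) r b)^[j] y₁ + k + 1} =
      ⋂ j ∈ Finset.range q, ⋃ k : ℤ, {f : AnalyticCircleSpace δ |
        (liftFun (unitFun hδ f) r b)^[j] z₁ + k < y₂ ∧
        z₂ < (liftFun (unitFun hδ f) r b)^[j] y₁ + k + 1} := by
    ext f
    simp
  rw [this]
  refine isOpen_biInter_finset fun j _ => isOpen_iUnion fun k => ?_
  exact (isOpen_lt ((hc _ _).add continuous_const) continuous_const).inter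
    (isOpen_lt continuous_const (((hc _ _).add continuous_const).add continuous_const))

theorem measurableSet_infCyclicity_le_one (p : ℕ) {q : ℕ} (hq : 0 < q) :
    MeasurableSet {f : AnalyticCircleSpace δ |
      infCyclicity (f.toCircleFun hδ) ((p : ℝ) / q) ≤ 1} := by
  -- The uncountable union over `r` and `a` is harmless because each member is open.
  have hopen : ∀ n : ℕ, IsOpen {f : AnalyticCircleSpace δ | ∃ r a : ℝ, |a| * n < 1 ∧
      TwoSinks (liftFun (unitFun hδ f) r (a / (2 * π))) p q} := by
    intro n
    simp only [Set.ofPred_exists, Set.ofPred_and]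
    exact isOpen_iUnion fun r => isOpen_iUnion fun a =>
      isOpen_const.inter (isOpen_setOf_twoSinks hδ r _ p q)
  have heq : {f : AnalyticCircleSpace δ | infCyclicity (f.toCircleFun hδ) ((p : ℝ) / q) ≤ 1} =
      ⋃ n : ℕ, {f : AnalyticCircleSpace δ | 2 * ‖f‖ / δ < n} \ {f | ∃ r a : ℝ, |a| * n < 1 ∧
        TwoSinks (liftFun (unitFun hδ f) r (a / (2 * π))) p q} := by
    ext f
    rw [Set.mem_iUnion]
    exact infCyclicity_le_one_iff_exists_nat hδ f hq
  rw [heq]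
  exact MeasurableSet.iUnion fun n =>
    (isOpen_lt (by fun_prop) continuous_const).measurableSet.diff (hopen n).measurableSet

theorem measurableSet_essentialIC_one : MeasurableSet (essentialIC 1 hδ) := by
  unfold essentialIC EssentiallyBoundedCyclicity
  simp only [Set.ofPred_exists, Set.ofPred_forall]
  exact MeasurableSet.iUnion fun Q => MeasurableSet.iInter fun p => MeasurableSet.iInter fun q =>
    MeasurableSet.iInter fun hq => MeasurableSet.iInter fun _ => MeasurableSet.iInter fun _ =>
      measurableSet_infCyclicity_le_one hδ p hq

end Borel

/-! ### The displacement of the iterates near a rational rotation -/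

section Displacement

variable {φ φ₁ φ₂ : ℝ → ℝ} {α : ℝ}

/-- If `r = α + b s`, the `j`-th iterate of `x ↦ x + r + b φ(x)` is
`x + j α + b * displacement φ α j b s x`. -/
def displacement (φ : ℝ → ℝ) (α : ℝ) : ℕ → ℝ → ℝ → ℝ → ℝ
  | 0, _, _, _ => 0
  | j + 1, b, s, x => displacement φ α j b s x + s + φ (x + j * α + b * displacement φ α j b s x)

/-- The first derivative of `displacement` in the last variable. -/
def displacementDeriv (φ φ₁ : ℝ → ℝ) (α : ℝ) : ℕ → ℝ → ℝ → ℝ → ℝ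
  | 0, _, _, _ => 0
  | j + 1, b, s, x => displacementDeriv φ φ₁ α j b s x +
      φ₁ (x + j * α + b * displacement φ α j b s x) * (1 + b * displacementDeriv φ φ₁ α j b s x)

/-- The second derivative of `displacement` in the last variable. -/
def displacementDeriv2 (φ φ₁ φ₂ : ℝ → ℝ) (α : ℝ) : ℕ → ℝ → ℝ → ℝ → ℝ
  | 0, _, _, _ => 0
  | j + 1, b, s, x => displacementDeriv2 φ φ₁ φ₂ α j b s x +
      (φ₂ (x + j * α + b * displacement φ α j b s x) * (1 + b * displacementDeriv φ φ₁ α j b s x) *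
        (1 + b * displacementDeriv φ φ₁ α j b s x) +
      φ₁ (x + j * α + b * displacement φ α j b s x) * (b * displacementDeriv2 φ φ₁ φ₂ α j b s x))

theorem iterate_liftFun {r b s : ℝ} (hr : r = α + b * s) (j : ℕ) (x : ℝ) :
    (liftFun φ r b)^[j] x = x + j * α + b * displacement φ α j b s x := by
  induction j with
  | zero => simp [displacement]
  | succ j ih =>
    rw [Function.iterate_succ_apply', ih, displacement, liftFun, hr]
    push_cast
    ring

theorem hasDerivAt_displacement (h₁ : ∀ x, HasDerivAt φ (φ₁ x) x) (j : ℕ) (b s x : ℝ) :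
    HasDerivAt (displacement φ α j b s) (displacementDeriv φ φ₁ α j b s x) x := by
  induction j with
  | zero => exact hasDerivAt_const x 0
  | succ j ih =>
    have hin : HasDerivAt (fun y => y + j * α + b * displacement φ α j b s y)
        (1 + b * displacementDeriv φ φ₁ α j b s x) x :=
      ((hasDerivAt_id x).add_const _).add (ih.const_mul b)
    exact (ih.add_const s).add ((h₁ _).comp x hin)

theorem hasDerivAt_displacementDeriv (h₁ : ∀ x, HasDerivAt φ (φ₁ x) x)
    (h₂ : ∀ x, HasDerivAt φ₁ (φ₂ x) x) (j : ℕ) (b s x : ℝ) :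
    HasDerivAt (displacementDeriv φ φ₁ α j b s) (displacementDeriv2 φ φ₁ φ₂ α j b s x) x := by
  induction j with
  | zero => exact hasDerivAt_const x 0
  | succ j ih =>
    have hin : HasDerivAt (fun y => y + j * α + b * displacement φ α j b s y)
        (1 + b * displacementDeriv φ φ₁ α j b s x) x :=
      ((hasDerivAt_id x).add_const _).add ((hasDerivAt_displacement h₁ j b s x).const_mul b)
    exact ih.add (((h₂ _).comp x hin).mul ((ih.const_mul b).const_add 1))

/-- At `b = 0` the parameter `s` enters the displacement only as a constant, so the limiting
derivatives are sums along the rotation, independent of `s`. -/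
theorem displacementDeriv_zero (j : ℕ) (s x : ℝ) :
    displacementDeriv φ φ₁ α j 0 s x = ∑ i ∈ Finset.range j, φ₁ (x + i * α) := by
  induction j with
  | zero => rfl
  | succ j ih => rw [displacementDeriv, ih, Finset.sum_range_succ]; simp

theorem displacementDeriv2_zero (j : ℕ) (s x : ℝ) :
    displacementDeriv2 φ φ₁ φ₂ α j 0 s x = ∑ i ∈ Finset.range j, φ₂ (x + i * α) := by
  induction j with
  | zero => rfl
  | succ j ih => rw [displacementDeriv2, ih, Finset.sum_range_succ]; simp

theorem continuous_displacement (hφ : Continuous φ) (j : ℕ) :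
    Continuous fun v : ℝ × ℝ × ℝ => displacement φ α j v.1 v.2.1 v.2.2 := by
  induction j with
  | zero => exact continuous_const
  | succ j ih => simp only [displacement]; fun_prop

theorem continuous_displacementDeriv (hφ : Continuous φ) (hφ₁ : Continuous φ₁) (j : ℕ) :
    Continuous fun v : ℝ × ℝ × ℝ => displacementDeriv φ φ₁ α j v.1 v.2.1 v.2.2 := by
  have := continuous_displacement (α := α) hφ
  induction j with
  | zero => exact continuous_const
  | succ j ih =>
    have hj := this j
    simp only [displacementDeriv]; fun_prop

theorem continuous_displacementDeriv2 (hφ : Continuous φ) (hφ₁ : Continuous φ₁)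
    (hφ₂ : Continuous φ₂) (j : ℕ) :
    Continuous fun v : ℝ × ℝ × ℝ => displacementDeriv2 φ φ₁ φ₂ α j v.1 v.2.1 v.2.2 := by
  have h1 := continuous_displacement (α := α) hφ
  have h2 := continuous_displacementDeriv (α := α) hφ hφ₁
  induction j with
  | zero => exact continuous_const
  | succ j ih =>
    have h1 := h1 j
    have h2 := h2 j
    simp only [displacementDeriv2]; fun_prop

theorem displacement_periodic (hφ : Function.Periodic φ 1) (j : ℕ) (b s : ℝ) :
    Function.Periodic (displacement φ α j b s) 1 := by
  intro x
  induction j with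
  | zero => rfl
  | succ j ih =>
    rw [displacement, displacement, ih, ← hφ (x + j * α + _)]
    congr 2
    ring

theorem displacementDeriv_periodic (hφ : Function.Periodic φ 1) (hφ₁ : Function.Periodic φ₁ 1)
    (j : ℕ) (b s : ℝ) : Function.Periodic (displacementDeriv φ φ₁ α j b s) 1 := by
  intro x
  induction j with
  | zero => rfl
  | succ j ih =>
    rw [displacementDeriv, displacementDeriv, ih, displacement_periodic hφ,
      ← hφ₁ (x + j * α + _)]
    congr 3
    ring

theorem displacementDeriv2_periodic (hφ : Function.Periodic φ 1) (hφ₁ : Function.Periodic φ₁ 1)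
    (hφ₂ : Function.Periodic φ₂ 1) (j : ℕ) (b s : ℝ) :
    Function.Periodic (displacementDeriv2 φ φ₁ φ₂ α j b s) 1 := by
  intro x
  induction j with
  | zero => rfl
  | succ j ih =>
    rw [displacementDeriv2, displacementDeriv2, ih, displacementDeriv_periodic hφ hφ₁,
      displacement_periodic hφ, ← hφ₁ (x + j * α + _), ← hφ₂ (x + j * α + _)]
    have : ∀ c : ℝ, x + 1 + j * α + c = x + j * α + c + 1 := fun c => by ring
    simp only [this]

/-- Periodicity reduces `x` to `[0, 1]`, and uniform continuity on a compact box does the rest. -/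
theorem exists_uniform_close {F : ℝ → ℝ → ℝ → ℝ}
    (hc : Continuous fun v : ℝ × ℝ × ℝ => F v.1 v.2.1 v.2.2)
    (hp : ∀ b s, Function.Periodic (F b s) 1) (M : ℝ) {η : ℝ} (hη : 0 < η) :
    ∃ b₀ > 0, ∀ b s x : ℝ, |b| < b₀ → |s| ≤ M → |F b s x - F 0 s x| < η := by
  have hK : IsCompact (Set.Icc (-1 : ℝ) 1 ×ˢ Set.Icc (-M) M ×ˢ Set.Icc (0 : ℝ) 1) :=
    isCompact_Icc.prod (isCompact_Icc.prod isCompact_Icc)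
  obtain ⟨b₀, hb₀, h⟩ := Metric.uniformContinuousOn_iff.1
    (hK.uniformContinuousOn_of_continuous hc.continuousOn) η hη
  refine ⟨min b₀ 1, by positivity, fun b s x hb hs => ?_⟩
  have hb1 := hb.trans_le (min_le_left _ _)
  have hb2 := hb.trans_le (min_le_right _ _)
  have hfr : ∀ b, F b s x = F b s (Int.fract x) := fun b => by
    conv_rhs => rw [← Int.self_sub_floor]
    exact ((hp b s).sub_int_mul_eq ⌊x⌋).symm.trans (by rw [mul_one])
  have hs' : s ∈ Set.Icc (-M) M := abs_le.1 hs
  have hx' : Int.fract x ∈ Set.Icc (0 : ℝ) 1 := ⟨Int.fract_nonneg x, (Int.fract_lt_one x).le⟩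
  rw [hfr b, hfr 0, ← Real.dist_eq]
  refine h (b, s, Int.fract x) ⟨abs_le.1 hb2.le, hs', hx'⟩ (0, s, Int.fract x)
    ⟨by norm_num, hs', hx'⟩ ?_
  simpa [Prod.dist_eq] using hb1

end Displacement

/-- When the return map has a fixed point, this yields `|r - p/q| ≤ |b| M`, which confines `s` to
the compact range `|s| ≤ M`. -/
theorem abs_iterate_liftFun_sub_le {φ : ℝ → ℝ} {M : ℝ} (hM : ∀ x, |φ x| ≤ M) (r b x : ℝ) (j : ℕ) :
    |(liftFun φ r b)^[j] x - x - j * r| ≤ j * (|b| * M) := by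
  induction j with
  | zero => simp
  | succ j ih =>
    rw [Function.iterate_succ_apply', liftFun]
    have h1 : |b * φ ((liftFun φ r b)^[j] x)| ≤ |b| * M := by
      rw [abs_mul]
      exact mul_le_mul_of_nonneg_left (hM _) (abs_nonneg b)
    push_cast
    rw [abs_le] at *
    constructor <;> linarith [ih.1, ih.2, h1.1, h1.2]

/-! ### Functions close to a cosine -/

theorem half_lt_cos {v : ℝ} (hv : |v| ≤ 1 / 8) : 1 / 2 < cos (2 * π * v) := by
  have hπ := Real.pi_pos
  rw [← Real.cos_abs, abs_mul, abs_of_pos (by positivity : 0 < 2 * π), ← Real.cos_pi_div_three]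
  exact Real.cos_lt_cos_of_nonneg_of_le_pi_div_two (by positivity) (by linarith) (by nlinarith)

theorem half_lt_sin {v : ℝ} (h1 : 1 / 8 ≤ v) (h2 : v ≤ 3 / 8) : 1 / 2 < sin (2 * π * v) := by
  have := half_lt_cos (v := v - 1 / 4) (abs_le.2 ⟨by linarith, by linarith⟩)
  rwa [show 2 * π * (v - 1 / 4) = 2 * π * v - π / 2 by ring, Real.cos_sub_pi_div_two] at this

theorem half_lt_neg_cos {v : ℝ} (h1 : 3 / 8 ≤ v) (h2 : v ≤ 5 / 8) : 1 / 2 < -cos (2 * π * v) := by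
  have := half_lt_cos (v := v - 1 / 2) (abs_le.2 ⟨by linarith, by linarith⟩)
  rwa [show 2 * π * (v - 1 / 2) = 2 * π * v - π by ring, Real.cos_sub_pi] at this

theorem half_lt_neg_sin {v : ℝ} (h1 : 5 / 8 ≤ v) (h2 : v ≤ 7 / 8) : 1 / 2 < -sin (2 * π * v) := by
  have := half_lt_sin (v := v - 1 / 2) (by linarith) (by linarith)
  rwa [show 2 * π * (v - 1 / 2) = 2 * π * v - π by ring, Real.sin_sub_pi] at this

/-- Where the derivative `K₁` of a function is close to `-A sin(2π(qx + θ))` in the `C¹` sense,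
the set `K₁ ≤ 0` is an interval in each period. -/
theorem nonpos_of_mem_Icc_of_close {K₁ K₂ : ℝ → ℝ} (hK : ∀ x, HasDerivAt K₁ (K₂ x) x) {q A θ : ℝ}
    (hq : 0 < q) (hA : 0 < A) (h₁ : ∀ x, |K₁ x + A * sin (2 * π * (q * x + θ))| ≤ A / 2)
    (h₂ : ∀ x, |K₂ x + 2 * π * q * A * cos (2 * π * (q * x + θ))| ≤ 2 * π * q * A / 2)
    {x y t : ℝ} (hidx : ⌊q * x + θ + 1 / 8⌋ = ⌊q * y + θ + 1 / 8⌋)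
    (hx : K₁ x ≤ 0) (hy : K₁ y ≤ 0) (hxt : x ≤ t) (hty : t ≤ y) : K₁ t ≤ 0 := by
  have hπ := Real.pi_pos
  -- With `v = q w + θ - n` in `[-1/8, 7/8)`, the period splits into four quarters: `K₁` decreases
  -- up to `1/8`, is negative up to `3/8`, increases up to `5/8`, and is positive afterwards.
  set n := ⌊q * x + θ + 1 / 8⌋ with hn
  have hsin : ∀ w, sin (2 * π * (q * w + θ)) = sin (2 * π * (q * w + θ - n)) := fun w => by
    rw [mul_sub, mul_comm (2 * π) (n : ℝ), Real.sin_sub_int_mul_two_pi]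
  have hcos : ∀ w, cos (2 * π * (q * w + θ)) = cos (2 * π * (q * w + θ - n)) := fun w => by
    rw [mul_sub, mul_comm (2 * π) (n : ℝ), Real.cos_sub_int_mul_two_pi]
  simp only [hsin, hcos, abs_le] at h₁ h₂
  have hx1 : (n : ℝ) ≤ q * x + θ + 1 / 8 := Int.floor_le _
  have hy1 : q * y + θ + 1 / 8 < n + 1 := by rw [hidx]; exact Int.lt_floor_add_one _
  have hmono : ∀ u v : ℝ, u ≤ v → q * u ≤ q * v := fun u v h => mul_le_mul_of_nonneg_left h hq.le
  have hxt' := hmono _ _ hxt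
  have hty' := hmono _ _ hty
  have hqA : 0 < 2 * π * q * A := by positivity
  have hcont : Continuous K₁ := continuous_iff_continuousAt.2 fun x => (hK x).continuousAt
  have hy2 : q * y + θ - n < 5 / 8 := by
    by_contra! h
    have h3 := half_lt_neg_sin h (by linarith)
    have := (h₁ y).1
    nlinarith
  rcases le_total (q * t + θ - n) (1 / 8) with h | h
  · refine (antitoneOn_of_deriv_nonpos (convex_Icc x t) hcont.continuousOn
      (fun w _ => (hK w).differentiableAt.differentiableWithinAt) (fun w hw => ?_)
      (Set.left_mem_Icc.2 hxt) (Set.right_mem_Icc.2 hxt) hxt).trans hx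
    rw [interior_Icc] at hw
    rw [(hK w).deriv]
    have h5 := hmono _ _ hw.1.le
    have h6 := hmono _ _ hw.2.le
    have h3 := half_lt_cos (v := q * w + θ - n) (abs_le.2 ⟨by linarith, by linarith⟩)
    have := (h₂ w).2
    nlinarith
  rcases le_total (q * t + θ - n) (3 / 8) with h' | h'
  · have h3 := half_lt_sin h h'
    have := (h₁ t).2
    nlinarith
  · refine (monotoneOn_of_deriv_nonneg (convex_Icc t y) hcont.continuousOn
      (fun w _ => (hK w).differentiableAt.differentiableWithinAt) (fun w hw => ?_)
      (Set.left_mem_Icc.2 hty) (Set.right_mem_Icc.2 hty) hty).trans hy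
    rw [interior_Icc] at hw
    rw [(hK w).deriv]
    have h5 := hmono _ _ hw.1.le
    have h6 := hmono _ _ hw.2.le
    have h3 := half_lt_neg_cos (v := q * w + θ - n) (by linarith) (by linarith)
    have := (h₂ w).1
    nlinarith

theorem deriv_nonpos_of_crossesDown {T K : ℝ → ℝ} {c d x : ℝ} (hc : 0 < c)
    (hT : ∀ y, T y - y = c * K y) (hK : HasDerivAt K d x) (hx : T x = x) (h : CrossesDown T x) :
    d ≤ 0 := by
  by_contra! hd
  have h1 := (hasDerivAt_iff_tendsto_slope.1 hK).eventually (lt_mem_nhds hd)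
  rw [eventually_nhdsWithin_iff] at h1
  obtain ⟨ε, hε, h2⟩ := Metric.eventually_nhds_iff.1 h1
  obtain ⟨z, hz1, hz2, hz3⟩ := (h ε hε).2
  have h3 := h2 (show dist z x < ε by rw [Real.dist_eq, abs_lt]; constructor <;> linarith)
    (show z ≠ x from hz1.ne')
  have hKx : K x = 0 := by
    have := hT x
    rw [hx, sub_self] at this
    exact (mul_eq_zero.1 this.symm).resolve_left hc.ne'
  rw [slope_def_field, hKx, sub_zero] at h3
  have h4 : 0 < K z := by
    have := mul_pos h3 (sub_pos.2 hz1)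
    rwa [div_mul_cancel₀ _ (sub_pos.2 hz1).ne'] at this
  have := hT z
  have := mul_pos hc h4
  linarith

/-- Both crossings have `K₁ ≤ 0`, so `K` is nonincreasing between them. As it vanishes at the right
end it is nonnegative in between, while a downward crossing at the left end requires negative values
just after it. -/
theorem eq_of_crossesDown_of_close {T K K₁ K₂ : ℝ → ℝ} {c : ℝ} (hc : 0 < c)
    (hT : ∀ y, T y - y = c * K y) (hK : ∀ x, HasDerivAt K (K₁ x) x)
    (hK₁ : ∀ x, HasDerivAt K₁ (K₂ x) x) {q A θ : ℝ}
    (hq : 0 < q) (hA : 0 < A) (h₁ : ∀ x, |K₁ x + A * sin (2 * π * (q * x + θ))| ≤ A / 2)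
    (h₂ : ∀ x, |K₂ x + 2 * π * q * A * cos (2 * π * (q * x + θ))| ≤ 2 * π * q * A / 2)
    {x y : ℝ} (hx : T x = x) (hy : T y = y) (hxc : CrossesDown T x) (hyc : CrossesDown T y)
    (hidx : ⌊q * x + θ + 1 / 8⌋ = ⌊q * y + θ + 1 / 8⌋) : x = y := by
  wlog hxy : x ≤ y generalizing x y
  · exact (this hy hx hyc hxc hidx.symm (le_of_not_ge hxy)).symm
  by_contra hne
  have hlt : x < y := lt_of_le_of_ne hxy hne
  have hx1 := deriv_nonpos_of_crossesDown hc hT (hK x) hx hxc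
  have hy1 := deriv_nonpos_of_crossesDown hc hT (hK y) hy hyc
  obtain ⟨z, hz1, hz2, hz3⟩ := (hxc (y - x) (by linarith)).2
  have hcont : Continuous K := continuous_iff_continuousAt.2 fun x => (hK x).continuousAt
  have hanti := antitoneOn_of_deriv_nonpos (convex_Icc x y) hcont.continuousOn
    (fun w _ => (hK w).differentiableAt.differentiableWithinAt) (fun w hw => by
      rw [interior_Icc] at hw
      rw [(hK w).deriv]
      exact nonpos_of_mem_Icc_of_close hK₁ hq hA h₁ h₂ hidx hx1 hy1 hw.1.le hw.2.le)
  have h3 := hanti (⟨hz1.le, by linarith⟩ : z ∈ Set.Icc x y) (Set.right_mem_Icc.2 hxy)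
    (by linarith)
  have h4 := hT z
  have h5 := hT y
  have h6 := mul_le_mul_of_nonneg_left h3 hc.le
  linarith

theorem CrossesDown.add_int {G : CircleDeg1Lift} {p : ℤ} {q : ℕ} {x : ℝ}
    (h : CrossesDown (returnMap G p q) x) (k : ℤ) : CrossesDown (returnMap G p q) (x + k) := by
  have hk : ∀ y, returnMap G p q (y + k) = returnMap G p q y + k := fun y => by
    rw [returnMap, returnMap, lift_iterate_add_int]
    ring
  intro ε hε
  obtain ⟨⟨y, hy1, hy2, hy3⟩, z, hz1, hz2, hz3⟩ := h ε hε
  exact ⟨⟨y + k, by linarith, by linarith, by rw [hk]; linarith⟩,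
    z + k, by linarith, by linarith, by rw [hk]; linarith⟩

/-- A combinatorial form of the statement that there is only one orbit of sinks: sinks are
determined by their index modulo `q`, and an orbit has `q` points. -/
theorem exists_iterate_add_int_eq {G : CircleDeg1Lift} {p : ℤ} {q : ℕ} (hq : 0 < q)
    (hpq : IsCoprime p (q : ℤ)) (hτ : G.translationNumber = p / q) (hc : Continuous G)
    (hs : StrictMono G) {θ : ℝ}
    (huniq : ∀ x y, returnMap G p q x = x → returnMap G p q y = y →
      CrossesDown (returnMap G p q) x → CrossesDown (returnMap G p q) y →
      ⌊q * x + θ + 1 / 8⌋ = ⌊q * y + θ + 1 / 8⌋ → x = y)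
    {x₁ x₂ : ℝ} (hx₁ : returnMap G p q x₁ = x₁) (hx₂ : returnMap G p q x₂ = x₂)
    (h₁ : CrossesDown (returnMap G p q) x₁) (h₂ : CrossesDown (returnMap G p q) x₂) :
    ∃ (j : ℕ) (k : ℤ), G^[j] x₁ + k = x₂ := by
  have : NeZero q := ⟨hq.ne'⟩
  set idx : ℝ → ℤ := fun x => ⌊q * x + θ + 1 / 8⌋ with hidx
  have hfix : ∀ (j : ℕ) (k : ℤ), returnMap G p q (G^[j] x₁ + k) = G^[j] x₁ + k := by
    intro j k
    rw [returnMap] at hx₁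
    have h3 : G^[q] x₁ = x₁ + p := by linarith
    rw [returnMap, lift_iterate_add_int, ← Function.iterate_add_apply, add_comm q j,
      Function.iterate_add_apply, h3, lift_iterate_add_int]
    ring
  have hcr : ∀ (j : ℕ) (k : ℤ), CrossesDown (returnMap G p q) (G^[j] x₁ + k) := fun j k =>
    (h₁.iterate hc hs j).add_int k
  have hmod : ∀ x y, ((idx x : ℤ) : ZMod q) = idx y → ∃ k : ℤ, idx (x + k) = idx y := by
    intro x y h
    rw [ZMod.intCast_eq_intCast_iff_dvd_sub] at h
    obtain ⟨k, hk⟩ := h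
    refine ⟨k, ?_⟩
    have : idx (x + k) = idx x + q * k := by
      simp only [hidx]
      rw [← Int.floor_add_intCast]
      congr 1
      push_cast
      ring
    rw [this]
    linarith
  -- An integer translation by `k` changes the index by `q k`, so the index modulo `q` lives on the
  -- circle. The `q` points of the orbit have distinct residues and thus exhaust them, including
  -- that of `x₂`.
  have hinj : Function.Injective fun j : Fin q => ((idx (G^[j] x₁) : ℤ) : ZMod q) := by
    intro i j hij
    obtain ⟨k, hk⟩ := hmod _ _ hij
    have h3 := huniq _ _ (hfix i k) (by simpa using hfix j 0) (hcr i k)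
      (by simpa using hcr j 0) hk
    exact Fin.ext (eq_of_iterate_eq_add_int hq hpq hτ i.2 j.2 h3)
  have hsurj := ((Fintype.bijective_iff_injective_and_card _).2
    ⟨hinj, by rw [Fintype.card_fin, ZMod.card]⟩).2
  obtain ⟨j, hj⟩ := hsurj (idx x₂ : ZMod q)
  obtain ⟨k, hk⟩ := hmod _ _ hj
  exact ⟨j, k, huniq _ _ (hfix j k) hx₂ (hcr j k) h₂ hk⟩

/-- If the average of `φ` along the rotation by `p / q` is `C²` close to a nondegenerate cosine,
then for small `b` two sinks with rotation number `p / q` lie on the same orbit. -/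
theorem exists_forall_sinks_same_orbit {φ φ₁ φ₂ : ℝ → ℝ} (hφ₁ : ∀ x, HasDerivAt φ (φ₁ x) x)
    (hφ₂ : ∀ x, HasDerivAt φ₁ (φ₂ x) x) (hcφ : Continuous φ₂) (hp₀ : Function.Periodic φ 1)
    (hp₁ : Function.Periodic φ₁ 1) (hp₂ : Function.Periodic φ₂ 1) {M : ℝ} (hM : ∀ x, |φ x| ≤ M)
    {p : ℤ} {q : ℕ} (hq : 0 < q) (hpq : IsCoprime p (q : ℤ)) {A θ : ℝ} (hA : 0 < A)
    (h₁ : ∀ x, |∑ i ∈ Finset.range q, φ₁ (x + i * (p / q : ℝ)) +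
      A * sin (2 * π * (q * x + θ))| ≤ A / 4)
    (h₂ : ∀ x, |∑ i ∈ Finset.range q, φ₂ (x + i * (p / q : ℝ)) +
      2 * π * q * A * cos (2 * π * (q * x + θ))| ≤ 2 * π * q * A / 4) :
    ∃ b₀ > 0, ∀ r b : ℝ, |b| < b₀ → ∀ G : CircleDeg1Lift, (∀ x, G x = liftFun φ r b x) →
      StrictMono G → G.translationNumber = p / q → ∀ x₁ x₂ : ℝ, returnMap G p q x₁ = x₁ →
      returnMap G p q x₂ = x₂ → CrossesDown (returnMap G p q) x₁ →
      CrossesDown (returnMap G p q) x₂ → ∃ (j : ℕ) (k : ℤ), G^[j] x₁ + k = x₂ := by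
  have hπ := Real.pi_pos
  have hq0 : (0 : ℝ) < q := by exact_mod_cast hq
  have hc₀ : Continuous φ := continuous_iff_continuousAt.2 fun x => (hφ₁ x).continuousAt
  have hc₁ : Continuous φ₁ := continuous_iff_continuousAt.2 fun x => (hφ₂ x).continuousAt
  set α : ℝ := p / q with hα
  -- Half of the tolerance `A/2` is spent on the averaged function and the other half on passing
  -- from `b = 0` to small `b`. The second derivative is treated likewise.
  obtain ⟨b₁, hb₁, hu₁⟩ := exists_uniform_close
    (continuous_displacementDeriv (α := α) hc₀ hc₁ q)
    (displacementDeriv_periodic hp₀ hp₁ q) M (η := A / 4) (by positivity)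
  obtain ⟨b₂, hb₂, hu₂⟩ := exists_uniform_close
    (continuous_displacementDeriv2 (α := α) hc₀ hc₁ hcφ q)
    (displacementDeriv2_periodic hp₀ hp₁ hp₂ q) M (η := 2 * π * q * A / 4) (by positivity)
  refine ⟨min b₁ b₂, lt_min hb₁ hb₂, ?_⟩
  intro r b hb G hG hsm hτ x₁ x₂ hx₁ hx₂ hs₁ hs₂
  have hGf : ⇑G = liftFun φ r b := funext hG
  have hGc : Continuous G := by rw [hGf]; unfold liftFun; fun_prop
  have hfix : (liftFun φ r b)^[q] x₁ = x₁ + p := by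
    rw [returnMap, hGf] at hx₁
    linarith
  have hrot := abs_iterate_liftFun_sub_le hM r b x₁ q
  rw [hfix] at hrot
  have hrα : |r - α| ≤ |b| * M := by
    have h3 : x₁ + p - x₁ - q * r = -(q * (r - α)) := by
      rw [hα]; field_simp; ring
    rw [h3, abs_neg, abs_mul, abs_of_pos hq0] at hrot
    exact le_of_mul_le_mul_left hrot hq0
  -- At `b = 0` the map is the rotation by `p/q` itself, whose return map is the identity and has no
  -- crossings.
  have hb0 : b ≠ 0 := by
    rintro rfl
    obtain ⟨z, -, -, hz⟩ := (hs₁ 1 one_pos).2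
    have h3 : r = α + 0 * 0 := by
      rw [abs_zero, zero_mul] at hrα
      have := abs_nonpos_iff.1 hrα
      linarith
    rw [returnMap, hGf, iterate_liftFun h3, hα] at hz
    have : (q : ℝ) * (p / q) = p := by field_simp
    linarith
  set s := (r - α) / b with hs
  have hr : r = α + b * s := by rw [hs]; field_simp; ring
  have hsM : |s| ≤ M := by
    rw [hs, abs_div, div_le_iff₀ (abs_pos.2 hb0), mul_comm]
    exact hrα
  have hdisp : ∀ y, returnMap G p q y - y = b * displacement φ α q b s y := by
    intro y
    rw [returnMap, hGf, iterate_liftFun hr, hα]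
    field_simp
    ring
  have e₁ : ∀ x, |displacementDeriv φ φ₁ α q b s x + A * sin (2 * π * (q * x + θ))| ≤ A / 2 := by
    intro x
    have h3 := (hu₁ b s x (hb.trans_le (min_le_left _ _)) hsM).le
    rw [displacementDeriv_zero] at h3
    have h4 := h₁ x
    rw [abs_le] at *
    constructor <;> linarith [h3.1, h3.2, h4.1, h4.2]
  have e₂ : ∀ x, |displacementDeriv2 φ φ₁ φ₂ α q b s x +
      2 * π * q * A * cos (2 * π * (q * x + θ))| ≤ 2 * π * q * A / 2 := by
    intro x
    have h3 := (hu₂ b s x (hb.trans_le (min_le_right _ _)) hsM).le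
    rw [displacementDeriv2_zero] at h3
    have h4 := h₂ x
    rw [abs_le] at *
    constructor <;> linarith [h3.1, h3.2, h4.1, h4.2]
  have d₁ := hasDerivAt_displacement (α := α) hφ₁ q b s
  have d₂ := hasDerivAt_displacementDeriv (α := α) hφ₁ hφ₂ q b s
  rcases lt_or_gt_of_ne hb0 with hneg | hpos
  -- A negative `b` reverses the displacement, which amounts to shifting the phase of the cosine by
  -- half a period.
  · refine exists_iterate_add_int_eq hq hpq hτ hGc hsm (θ := θ + 1 / 2) ?_ hx₁ hx₂ hs₁ hs₂
    intro x y hx hy hxs hys hxy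
    have hshift : ∀ w : ℝ, 2 * π * (q * w + (θ + 1 / 2)) = 2 * π * (q * w + θ) + π :=
      fun w => by ring
    refine eq_of_crossesDown_of_close (c := -b) (K := fun y => -displacement φ α q b s y)
      (by linarith) (fun y => by rw [hdisp]; ring) (fun x => (d₁ x).neg)
      (fun x => (d₂ x).neg) hq0 hA (fun x => ?_) (fun x => ?_) hx hy hxs hys hxy
    · rw [hshift, Real.sin_add_pi, ← abs_neg]
      convert e₁ x using 2
      ring
    · rw [hshift, Real.cos_add_pi, ← abs_neg]
      convert e₂ x using 2
      ring
  · refine exists_iterate_add_int_eq hq hpq hτ hGc hsm (θ := θ) ?_ hx₁ hx₂ hs₁ hs₂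
    intro x y hx hy hxs hys hxy
    exact eq_of_crossesDown_of_close hpos hdisp d₁ d₂ hq0 hA e₁ e₂ hx hy hxs hys hxy

section

variable {δ : ℝ} (hδ : 0 < δ) (f : AnalyticCircleSpace δ)

theorem infCyclicity_le_one_of_close {φ₁ φ₂ : ℝ → ℝ}
    (hφ₁ : ∀ x, HasDerivAt (unitFun hδ f) (φ₁ x) x)
    (hφ₂ : ∀ x, HasDerivAt φ₁ (φ₂ x) x) (hcφ : Continuous φ₂)
    (hp₁ : Function.Periodic φ₁ 1) (hp₂ : Function.Periodic φ₂ 1)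
    {p q : ℕ} (hq : 0 < q) (hpq : p.Coprime q) {A θ : ℝ} (hA : 0 < A)
    (h₁ : ∀ x, |∑ i ∈ Finset.range q, φ₁ (x + i * (p / q : ℝ)) +
      A * sin (2 * π * (q * x + θ))| ≤ A / 4)
    (h₂ : ∀ x, |∑ i ∈ Finset.range q, φ₂ (x + i * (p / q : ℝ)) +
      2 * π * q * A * cos (2 * π * (q * x + θ))| ≤ 2 * π * q * A / 4) :
    infCyclicity (f.toCircleFun hδ) ((p : ℝ) / q) ≤ 1 := by
  have hπ := Real.pi_pos
  obtain ⟨b₀, hb₀, h⟩ := exists_forall_sinks_same_orbit hφ₁ hφ₂ hcφ (unitFun_add_one hδ f) hp₁ hp₂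
    (M := ‖f‖) (fun x => abs_toRealFun_le hδ f _) (p := p) hq (Nat.isCoprime_iff_coprime.2 hpq)
    hA h₁ h₂
  rw [infCyclicity_le_one_iff]
  set L := 2 * ‖f‖ / δ with hL
  have hL0 : 0 ≤ L := by positivity
  refine ⟨min (b₀ * (2 * π)) (1 / (L + 1)), by positivity, fun r a ha hrot hN => ?_⟩
  have ha1 := ha.trans_le (min_le_left _ _)
  have ha2 := ha.trans_le (min_le_right _ _)
  have haL : |a| * L < 1 := by
    rw [lt_div_iff₀ (by positivity)] at ha2
    nlinarith [abs_nonneg a]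
  obtain ⟨G, hc, hG, hτ⟩ := hrot
  obtain ⟨m, rfl⟩ := exists_familyLift_eq hδ f haL hc hG
  have hτ' : (familyLift hδ f (r + m) haL).translationNumber = ((p : ℤ) : ℝ) / q := by
    simpa using hτ
  obtain ⟨x₁, x₂, hx₁, hx₂, hs₁, hs₂, hne⟩ :=
    exists_crossesDown_of_two_attracting (p := p) hc hG hq hτ' hN
  obtain ⟨j, k, hjk⟩ := h (r + m) (a / (2 * π))
    (by rwa [abs_div, abs_of_pos (by positivity : 0 < 2 * π), div_lt_iff₀ (by positivity)])
    _ (fun x => rfl) (strictMono_liftFun hδ f _ haL) hτ' x₁ x₂ hx₁ hx₂ hs₁ hs₂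
  exact hne j k hjk

end

/-! ### Fourier coefficients of functions holomorphic in a strip -/

/-- Cauchy's theorem on a rectangle of width `2π`: the vertical sides cancel by periodicity. -/
theorem intervalIntegral_add_mul_I_eq {δ η : ℝ} (hη : |η| < δ) {K : ℂ → ℂ}
    (hK : DifferentiableOn ℂ K (strip δ))
    (hp : ∀ z ∈ strip δ, K (z + ((2 * π : ℝ) : ℂ)) = K z) :
    ∫ x in (0 : ℝ)..2 * π, K (x + η * Complex.I) = ∫ x in (0 : ℝ)..2 * π, K x := by
  have hlt : ∀ y ∈ Set.uIcc 0 η, |y| < δ := by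
    intro y hy
    rcases le_total 0 η with h | h
    · rw [Set.uIcc_of_le h] at hy
      rw [abs_of_nonneg hy.1]
      rw [abs_of_nonneg h] at hη
      linarith [hy.2]
    · rw [Set.uIcc_of_ge h] at hy
      rw [abs_of_nonpos hy.2]
      rw [abs_of_nonpos h] at hη
      linarith [hy.1]
  have h := Complex.integral_boundary_rect_eq_zero_of_differentiableOn K 0
    ((2 * π : ℝ) + η * Complex.I) (hK.mono fun z hz => by
      have h1 := (Complex.mem_reProdIm.1 hz).2
      simp only [Complex.zero_im, Complex.add_im, Complex.ofReal_im, Complex.mul_im,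
        Complex.ofReal_re, Complex.I_im, Complex.I_re, mul_one, mul_zero, add_zero, zero_add] at h1
      exact hlt _ h1)
  have hside : ∫ y in (0 : ℝ)..η, K ((2 * π : ℝ) + y * Complex.I) =
      ∫ y in (0 : ℝ)..η, K ((0 : ℝ) + y * Complex.I) := by
    refine intervalIntegral.integral_congr fun y hy => ?_
    rw [add_comm, Complex.ofReal_zero, zero_add]
    refine hp _ ?_
    show |((y : ℂ) * Complex.I).im| < δ
    simpa using hlt y hy
  simp at h hside
  rw [hside] at h
  have h2 := sub_eq_zero.1 (by simpa using h)
  exact h2.symm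

section Fourier

instance fact_two_pi_pos : Fact (0 < 2 * π) := ⟨Real.two_pi_pos⟩

variable {δ : ℝ} (hδ : 0 < δ) (f : AnalyticCircleSpace δ)

/-- The Fourier coefficients of `f`. -/
noncomputable def coeff (k : ℤ) : ℂ :=
  fourierCoeff (fun x : AddCircle (2 * π) => (f.toCircleFun hδ x : ℂ)) k

theorem fourier_eq_exp (k : ℤ) (x : ℝ) :
    fourier k (x : AddCircle (2 * π)) = Complex.exp (k * x * Complex.I) := by
  have hπ : (π : ℂ) ≠ 0 := by exact_mod_cast Real.pi_ne_zero
  rw [fourier_coe_apply]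
  congr 1
  push_cast
  field_simp

theorem coeff_eq_integral (k : ℤ) : coeff hδ f k =
    ((1 / (2 * π) : ℝ) : ℂ) * ∫ x in (0 : ℝ)..2 * π,
      Complex.exp (-(k * x * Complex.I)) * holoExt f x := by
  rw [coeff, fourierCoeff_eq_intervalIntegral _ _ 0, zero_add, Complex.real_smul]
  congr 1
  refine intervalIntegral.integral_congr fun x _ => ?_
  simp only [smul_eq_mul]
  rw [fourier_eq_exp, ← ofReal_toRealFun hδ]
  push_cast
  rw [neg_mul, neg_mul]
  rfl

theorem norm_coeff_le {η : ℝ} (hη0 : 0 ≤ η) (hη : η < δ) (k : ℤ) :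
    ‖coeff hδ f k‖ ≤ ‖f‖ * Real.exp (-(η * |(k : ℝ)|)) := by
  have hπ := Real.pi_pos
  -- On the line `Im z = e` the factor `exp(-ikz)` has modulus `exp(k e)`, so the contour moves
  -- towards the side where it decays.
  obtain ⟨e, he, hke⟩ : ∃ e : ℝ, |e| = η ∧ k * e = -(η * |(k : ℝ)|) := by
    rcases le_total 0 (k : ℝ) with h | h
    · exact ⟨-η, by rw [abs_neg, abs_of_nonneg hη0], by rw [abs_of_nonneg h]; ring⟩
    · exact ⟨η, abs_of_nonneg hη0, by rw [abs_of_nonpos h]; ring⟩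
  set K : ℂ → ℂ := fun z => Complex.exp (-(k * z * Complex.I)) * holoExt f z with hK
  have hKd : DifferentiableOn ℂ K (strip δ) := by
    have h1 : Differentiable ℂ fun z : ℂ => Complex.exp (-(k * z * Complex.I)) := by fun_prop
    exact h1.differentiableOn.mul (differentiableOn_holoExt f)
  have hKp : ∀ z ∈ strip δ, K (z + ((2 * π : ℝ) : ℂ)) = K z := by
    intro z hz
    simp only [hK]
    rw [holoExt_add_two_pi f hz]
    congr 1
    rw [show -(k * (z + ((2 * π : ℝ) : ℂ)) * Complex.I) =
      -(k * z * Complex.I) + ((-k : ℤ) : ℂ) * (2 * π * Complex.I) by push_cast; ring,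
      Complex.exp_add, Complex.exp_int_mul_two_pi_mul_I, mul_one]
  have hint := intervalIntegral_add_mul_I_eq (η := e) (by rw [he]; exact hη) hKd hKp
  rw [coeff_eq_integral]
  change ‖_ * ∫ x in (0 : ℝ)..2 * π, K x‖ ≤ _
  rw [← hint]
  have hbound : ‖∫ x in (0 : ℝ)..2 * π, K (x + e * Complex.I)‖ ≤
      Real.exp (-(η * |(k : ℝ)|)) * ‖f‖ * |2 * π - 0| := by
    refine intervalIntegral.norm_integral_le_of_norm_le_const fun x _ => ?_
    simp only [hK]
    rw [norm_mul]
    have hstrip : (x : ℂ) + e * Complex.I ∈ strip δ := by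
      show |((x : ℂ) + e * Complex.I).im| < δ
      simpa [he] using hη
    refine mul_le_mul (le_of_eq ?_) (norm_holoExt_le f hstrip) (norm_nonneg _) (Real.exp_nonneg _)
    rw [Complex.norm_exp]
    congr 1
    rw [← hke]
    simp
  rw [norm_mul, Complex.norm_real, Real.norm_of_nonneg (by positivity)]
  rw [sub_zero, abs_of_pos (by positivity : 0 < 2 * π)] at hbound
  generalize ‖f‖ = B at hbound ⊢
  calc 1 / (2 * π) * ‖∫ x in (0 : ℝ)..2 * π, K (x + e * Complex.I)‖
      ≤ 1 / (2 * π) * (Real.exp (-(η * |(k : ℝ)|)) * B * (2 * π)) := by gcongr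
    _ = B * Real.exp (-(η * |(k : ℝ)|)) := by field_simp

theorem summable_pow_mul_exp_neg_abs (m : ℕ) {η : ℝ} (hη : 0 < η) :
    Summable fun k : ℤ => |(k : ℝ)| ^ m * Real.exp (-(η * |(k : ℝ)|)) := by
  have h := Real.summable_pow_mul_exp_neg_nat_mul m hη
  refine Summable.of_nat_of_neg ?_ ?_
  · simpa using h
  · simpa using h

theorem summable_pow_mul_coeff (m : ℕ) :
    Summable fun k : ℤ => |(k : ℝ)| ^ m * ‖coeff hδ f k‖ := by
  refine Summable.of_nonneg_of_le (fun k => by positivity) (fun k => ?_)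
    ((summable_pow_mul_exp_neg_abs m (half_pos hδ)).mul_left ‖f‖)
  have := norm_coeff_le hδ f (half_pos hδ).le (half_lt_self hδ) k
  calc |(k : ℝ)| ^ m * ‖coeff hδ f k‖
      ≤ |(k : ℝ)| ^ m * (‖f‖ * Real.exp (-(δ / 2 * |(k : ℝ)|))) := by gcongr
    _ = _ := by ring

theorem hasSum_coeff (x : ℝ) :
    HasSum (fun k : ℤ => coeff hδ f k * Complex.exp (k * x * Complex.I)) (f.toRealFun hδ x) := by
  have hc : Continuous fun x : AddCircle (2 * π) => (f.toCircleFun hδ x : ℂ) := by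
    refine Complex.continuous_ofReal.comp (continuous_coinduced_dom.2 ?_)
    exact continuous_iff_continuousAt.2 fun y => (analyticAt_toRealFun hδ f y).continuousAt
  have hs : Summable (fourierCoeff fun x : AddCircle (2 * π) => (f.toCircleFun hδ x : ℂ)) := by
    refine Summable.of_norm (f := coeff hδ f) ?_
    simpa using summable_pow_mul_coeff hδ f 0
  have := has_pointwise_sum_fourier_series_of_summable
    (f := ⟨fun x : AddCircle (2 * π) => (f.toCircleFun hδ x : ℂ), hc⟩) hs (x : AddCircle (2 * π))
  simp only [fourier_eq_exp, smul_eq_mul] at this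
  exact this

theorem norm_exp_int_mul_I (k : ℤ) (x : ℝ) : ‖Complex.exp (k * x * Complex.I)‖ = 1 := by
  have := Complex.norm_exp_ofReal_mul_I (k * x)
  push_cast at this
  exact this

theorem hasDerivAt_exp_int_mul_I (k : ℤ) (x : ℝ) :
    HasDerivAt (fun x : ℝ => Complex.exp (k * x * Complex.I))
      (k * Complex.I * Complex.exp (k * x * Complex.I)) x := by
  have h1 : HasDerivAt (fun z : ℂ => k * z * Complex.I) (k * Complex.I) (x : ℂ) := by
    simpa using ((hasDerivAt_id (x : ℂ)).const_mul (k : ℂ)).mul_const Complex.I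
  have h2 := h1.cexp.comp_ofReal
  rwa [mul_comm] at h2

theorem hasDerivAt_fourier_tsum {d : ℤ → ℂ} (hd0 : Summable fun k => ‖d k‖)
    (hd1 : Summable fun k : ℤ => |(k : ℝ)| * ‖d k‖) (x : ℝ) :
    HasDerivAt (fun x : ℝ => ∑' k : ℤ, d k * Complex.exp (k * x * Complex.I))
      (∑' k : ℤ, d k * (k * Complex.I) * Complex.exp (k * x * Complex.I)) x := by
  refine hasDerivAt_tsum (y₀ := (0 : ℝ))
    (g := fun (k : ℤ) (x : ℝ) => d k * Complex.exp (k * x * Complex.I))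
    (g' := fun (k : ℤ) (x : ℝ) => d k * (k * Complex.I) * Complex.exp (k * x * Complex.I)) hd1 (fun k y => ?_) (fun k y => ?_) ?_ x
  · have := (hasDerivAt_exp_int_mul_I k y).const_mul (d k)
    rwa [← mul_assoc] at this
  · rw [norm_mul, norm_exp_int_mul_I, mul_one, norm_mul, norm_mul, Complex.norm_I, mul_one,
      Complex.norm_intCast, mul_comm]
  · refine Summable.of_norm ?_
    simpa [norm_exp_int_mul_I] using hd0

theorem ofReal_deriv_eq_tsum (x : ℝ) : ((deriv (f.toRealFun hδ) x : ℝ) : ℂ) =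
    ∑' k : ℤ, coeff hδ f k * (k * Complex.I) * Complex.exp (k * x * Complex.I) := by
  have h1 := (analyticAt_toRealFun hδ f x).differentiableAt.hasDerivAt.ofReal_comp
  have h2 := hasDerivAt_fourier_tsum (by simpa using summable_pow_mul_coeff hδ f 0)
    (by simpa using summable_pow_mul_coeff hδ f 1) x
  have h3 : (fun x : ℝ => ∑' k : ℤ, coeff hδ f k * Complex.exp (k * x * Complex.I)) =
      fun x => (f.toRealFun hδ x : ℂ) := funext fun x => (hasSum_coeff hδ f x).tsum_eq
  rw [h3] at h2
  exact h1.unique h2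

theorem ofReal_deriv_deriv_eq_tsum (x : ℝ) : ((deriv (deriv (f.toRealFun hδ)) x : ℝ) : ℂ) =
    ∑' k : ℤ, coeff hδ f k * (k * Complex.I) * (k * Complex.I) *
      Complex.exp (k * x * Complex.I) := by
  have h1 := (analyticAt_toRealFun hδ f x).deriv.differentiableAt.hasDerivAt.ofReal_comp
  have h2 := hasDerivAt_fourier_tsum (d := fun k : ℤ => coeff hδ f k * (k * Complex.I))
    (by simpa [mul_comm] using summable_pow_mul_coeff hδ f 1)
    ((summable_pow_mul_coeff hδ f 2).congr fun k => by
      rw [norm_mul, norm_mul, Complex.norm_I, Complex.norm_intCast]; ring) x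
  have h3 : (fun x : ℝ => ∑' k : ℤ, coeff hδ f k * (k * Complex.I) *
      Complex.exp (k * x * Complex.I)) = fun x => ((deriv (f.toRealFun hδ) x : ℝ) : ℂ) :=
    funext fun x => (ofReal_deriv_eq_tsum hδ f x).symm
  rw [h3] at h2
  exact h1.unique h2

theorem coeff_neg (k : ℤ) : coeff hδ f (-k) = starRingEnd ℂ (coeff hδ f k) := by
  rw [coeff, coeff, fourierCoeff_eq_intervalIntegral _ _ 0, fourierCoeff_eq_intervalIntegral _ _ 0,
    Complex.real_smul, Complex.real_smul, map_mul, Complex.conj_ofReal,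
    intervalIntegral.integral_of_le (by have := Real.pi_pos; linarith),
    intervalIntegral.integral_of_le (by have := Real.pi_pos; linarith), ← integral_conj]
  congr 1
  refine integral_congr_ae (Eventually.of_forall fun x => ?_)
  simp

end Fourier

/-! ### Averages along a rational rotation -/

/-- A geometric sum of powers of a `q`-th root of unity, which equals `1` exactly when `q ∣ k`
because `p` is prime to `q`. -/
theorem sum_exp_rotation_eq {p q : ℕ} (hq : 0 < q) (hpq : p.Coprime q) (k : ℤ) :
    ∑ i ∈ Finset.range q, Complex.exp (k * (2 * π * (i * (p / q))) * Complex.I) =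
      if (q : ℤ) ∣ k then (q : ℂ) else 0 := by
  have hq' : (q : ℂ) ≠ 0 := by exact_mod_cast hq.ne'
  set ζ := Complex.exp (2 * π * Complex.I / q) with hζ
  have hprim : IsPrimitiveRoot ζ q := Complex.isPrimitiveRoot_exp q hq.ne'
  have hterm : ∀ i : ℕ, Complex.exp (k * (2 * π * (i * (p / q))) * Complex.I) =
      (ζ ^ (k * p)) ^ i := by
    intro i
    rw [hζ, ← Complex.exp_int_mul, ← Complex.exp_nat_mul]
    congr 1
    push_cast
    field_simp
  simp only [hterm]
  split_ifs with h
  · have : ζ ^ (k * p) = 1 := (hprim.zpow_eq_one_iff_dvd _).2 (h.mul_right _)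
    simp [this]
  · have hne : ζ ^ (k * p) ≠ 1 := by
      intro h1
      have h2 := (hprim.zpow_eq_one_iff_dvd _).1 h1
      exact h ((Nat.isCoprime_iff_coprime.2 hpq).symm.dvd_of_dvd_mul_right h2)
    have h3 := mul_neg_geom_sum (ζ ^ (k * p)) q
    have h4 : (ζ ^ (k * p)) ^ q = 1 := by
      rw [← zpow_natCast, ← zpow_mul, mul_comm, zpow_mul, zpow_natCast, hprim.pow_eq_one, one_zpow]
    rw [h4, sub_self] at h3
    exact (mul_eq_zero.1 h3).resolve_left (sub_ne_zero.2 hne.symm)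

/-- Only multiples of `q` survive the averaging, each with weight `q`. The order `0` is absent, `±q`
form the main term, and all others satisfy `|k| ≥ 2q`. -/
theorem norm_sum_rotation_sub_le {d : ℤ → ℂ} (hd : Summable fun k => ‖d k‖) (hd0 : d 0 = 0)
    {p q : ℕ} (hq : 0 < q) (hpq : p.Coprime q) (y : ℝ) :
    ‖∑ i ∈ Finset.range q, ∑' k : ℤ,
        d k * Complex.exp (k * ((y + 2 * π * (i * (p / q)) : ℝ) : ℂ) * Complex.I) -
      q * (d q * Complex.exp (q * y * Complex.I) + d (-q) * Complex.exp (-(q * y * Complex.I)))‖ ≤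
    q * ∑' k : ℤ, if 2 * (q : ℤ) ≤ |k| then ‖d k‖ else 0 := by
  have hsum : ∀ x : ℝ, Summable fun k : ℤ => d k * Complex.exp (k * x * Complex.I) := fun x =>
    Summable.of_norm (by simpa [norm_exp_int_mul_I] using hd)
  set g : ℤ → ℂ := fun k => d k * Complex.exp (k * y * Complex.I) *
    if (q : ℤ) ∣ k then (q : ℂ) else 0 with hg
  have hg1 : HasSum g (∑ i ∈ Finset.range q, ∑' k : ℤ,
      d k * Complex.exp (k * ((y + 2 * π * (i * (p / q)) : ℝ) : ℂ) * Complex.I)) := by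
    have := hasSum_sum (s := Finset.range q) fun i _ => (hsum (y + 2 * π * (i * (p / q)))).hasSum
    refine this.congr_fun ?_ |> id
    intro k
    simp only [hg]
    rw [← sum_exp_rotation_eq hq hpq k, Finset.mul_sum]
    refine Finset.sum_congr rfl fun i _ => ?_
    rw [mul_assoc, ← Complex.exp_add]
    congr 2
    push_cast
    ring
  have hqne : (q : ℤ) ≠ -q := by omega
  have hg2 : HasSum (fun k : ℤ => if k ∈ ({(q : ℤ), -(q : ℤ)} : Finset ℤ) then g k else 0)
      (q * (d q * Complex.exp (q * y * Complex.I) +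
        d (-q) * Complex.exp (-(q * y * Complex.I)))) := by
    have h1 := hasSum_sum_of_ne_finset_zero (L := SummationFilter.unconditional ℤ)
      (s := ({(q : ℤ), -(q : ℤ)} : Finset ℤ)) (f := fun k : ℤ => if k ∈ ({(q : ℤ), -(q : ℤ)} : Finset ℤ) then g k else 0)
      (fun k hk => if_neg hk)
    convert h1 using 1
    rw [Finset.sum_pair hqne]
    simp [hg]
    ring
  have hdiff := hg1.sub hg2
  rw [← hdiff.tsum_eq, ← tsum_mul_left]
  have hbs : Summable fun k : ℤ => (q : ℝ) * if 2 * (q : ℤ) ≤ |k| then ‖d k‖ else 0 := by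
    refine Summable.mul_left _ (Summable.of_nonneg_of_le (fun k => ?_) (fun k => ?_) hd)
    · split_ifs <;> positivity
    · split_ifs
      · exact le_rfl
      · positivity
  refine tsum_of_norm_bounded hbs.hasSum fun k => ?_
  by_cases hk : k ∈ ({(q : ℤ), -(q : ℤ)} : Finset ℤ)
  · rw [if_pos hk, sub_self, norm_zero]
    split_ifs <;> positivity
  rw [if_neg hk, sub_zero]
  simp only [hg]
  rw [norm_mul, norm_mul, norm_exp_int_mul_I, mul_one]
  by_cases hdvd : (q : ℤ) ∣ k
  · rcases eq_or_ne k 0 with rfl | hk0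
    · rw [hd0, norm_zero, zero_mul]
      split_ifs <;> simp
    · have h2 : 2 * (q : ℤ) ≤ |k| := by
        obtain ⟨m, rfl⟩ := hdvd
        simp only [Finset.mem_insert, Finset.mem_singleton, not_or] at hk
        have hm0 : m ≠ 0 := by rintro rfl; simp at hk0
        have hm1 : m ≠ 1 := by rintro rfl; simp at hk
        have hm2 : m ≠ -1 := by rintro rfl; simp at hk
        have hm : 2 ≤ |m| := by
          rcases abs_cases m with h | h <;> omega
        rw [abs_mul, Nat.abs_cast, mul_comm]
        gcongr
      rw [if_pos hdvd, if_pos h2, Complex.norm_natCast, mul_comm]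
  · rw [if_neg hdvd, norm_zero, mul_zero]
    split_ifs <;> positivity

/-! ### Domination of the higher harmonics by the `q`-th coefficient -/

section Nondegenerate

variable {δ : ℝ} (hδ : 0 < δ) (f : AnalyticCircleSpace δ)

/-- The weighted sum of the Fourier coefficients of order at least `2q`. -/
noncomputable def coeffTail (q : ℕ) : ℝ :=
  ∑' k : ℤ, if 2 * (q : ℤ) ≤ |k| then |(k : ℝ)| ^ 2 * ‖coeff hδ f k‖ else 0

theorem coeff_mul_exp (q : ℕ) (y : ℝ) : coeff hδ f q * Complex.exp (q * y * Complex.I) =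
    ‖coeff hδ f q‖ * (cos (q * y + (coeff hδ f q).arg) +
      sin (q * y + (coeff hδ f q).arg) * Complex.I) := by
  conv_lhs => rw [← Complex.norm_mul_exp_arg_mul_I (coeff hδ f q)]
  rw [mul_assoc, ← Complex.exp_add]
  push_cast
  rw [← Complex.exp_mul_I]
  congr 2
  ring

theorem coeff_neg_mul_exp (q : ℕ) (y : ℝ) :
    coeff hδ f (-q) * Complex.exp (-(q * y * Complex.I)) =
    ‖coeff hδ f q‖ * (cos (q * y + (coeff hδ f q).arg) -
      sin (q * y + (coeff hδ f q).arg) * Complex.I) := by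
  have h := congrArg (starRingEnd ℂ) (coeff_mul_exp hδ f q y)
  rw [map_mul, ← coeff_neg, ← Complex.exp_conj] at h
  simp only [map_mul, map_add, Complex.conj_ofReal, Complex.conj_I, Complex.conj_natCast] at h
  rw [mul_neg, mul_neg, ← sub_eq_add_neg] at h
  exact h

/-- The modes `±q` of a real function are conjugate and combine into a single sine. The remainder
carries the weight `|k| ≤ k²`, so the same tail bounds both the first and the second derivative. -/
theorem abs_sum_deriv_add_le {p q : ℕ} (hq : 0 < q) (hpq : p.Coprime q) (y : ℝ) :
    |∑ i ∈ Finset.range q, deriv (f.toRealFun hδ) (y + 2 * π * (i * (p / q))) +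
      2 * q ^ 2 * ‖coeff hδ f q‖ * sin (q * y + (coeff hδ f q).arg)| ≤ q * coeffTail hδ f q := by
  have hsum : Summable fun k : ℤ => ‖coeff hδ f k * (k * Complex.I)‖ :=
    (summable_pow_mul_coeff hδ f 1).congr fun k => by
      rw [norm_mul, norm_mul, Complex.norm_I, Complex.norm_intCast]; ring
  have h := norm_sum_rotation_sub_le (d := fun k : ℤ => coeff hδ f k * (k * Complex.I)) hsum
    (by simp) hq hpq y
  simp only [← ofReal_deriv_eq_tsum hδ f] at h
  have hmain : (q : ℂ) * (coeff hδ f q * ((q : ℤ) * Complex.I) * Complex.exp (q * y * Complex.I) +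
      coeff hδ f (-q) * ((-q : ℤ) * Complex.I) * Complex.exp (-(q * y * Complex.I))) =
      ((-(2 * q ^ 2 * ‖coeff hδ f q‖ * sin (q * y + (coeff hδ f q).arg)) : ℝ) : ℂ) := by
    have h1 := coeff_mul_exp hδ f q y
    have h2 := coeff_neg_mul_exp hδ f q y
    push_cast at h1 h2 ⊢
    linear_combination (q : ℂ) ^ 2 * Complex.I * h1 - (q : ℂ) ^ 2 * Complex.I * h2 +
      2 * (q : ℂ) ^ 2 * ‖coeff hδ f q‖ * Complex.sin (q * y + (coeff hδ f q).arg) * Complex.I_sq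
  rw [hmain, ← Complex.ofReal_sum, ← Complex.ofReal_sub, Complex.norm_real, Real.norm_eq_abs,
    sub_neg_eq_add] at h
  refine h.trans (mul_le_mul_of_nonneg_left ?_ (Nat.cast_nonneg q))
  have hs2 := summable_pow_mul_coeff hδ f 2
  refine Summable.tsum_le_tsum (fun k => ?_)
    (Summable.of_nonneg_of_le (fun k => ?_) (fun k => ?_) hsum)
    (Summable.of_nonneg_of_le (fun k => ?_) (fun k => ?_) hs2)
  · split_ifs with hk
    · rw [norm_mul, norm_mul, Complex.norm_I, Complex.norm_intCast, mul_one, mul_comm]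
      refine mul_le_mul_of_nonneg_right ?_ (norm_nonneg _)
      have : (1 : ℝ) ≤ |(k : ℝ)| := by
        rw [← Int.cast_abs]
        exact_mod_cast (by omega : (1 : ℤ) ≤ |k|)
      nlinarith
    · exact le_rfl
  all_goals split_ifs <;> first | positivity | exact le_rfl

theorem abs_sum_deriv_deriv_add_le {p q : ℕ} (hq : 0 < q) (hpq : p.Coprime q) (y : ℝ) :
    |∑ i ∈ Finset.range q, deriv (deriv (f.toRealFun hδ)) (y + 2 * π * (i * (p / q))) +
      2 * q ^ 3 * ‖coeff hδ f q‖ * cos (q * y + (coeff hδ f q).arg)| ≤ q * coeffTail hδ f q := by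
  have hnorm : ∀ k : ℤ, ‖coeff hδ f k * (k * Complex.I) * (k * Complex.I)‖ =
      |(k : ℝ)| ^ 2 * ‖coeff hδ f k‖ := fun k => by
    rw [norm_mul, norm_mul, norm_mul, Complex.norm_I, Complex.norm_intCast]; ring
  have hsum : Summable fun k : ℤ => ‖coeff hδ f k * (k * Complex.I) * (k * Complex.I)‖ :=
    (summable_pow_mul_coeff hδ f 2).congr fun k => (hnorm k).symm
  have h := norm_sum_rotation_sub_le
    (d := fun k : ℤ => coeff hδ f k * (k * Complex.I) * (k * Complex.I)) hsum (by simp) hq hpq y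
  simp only [← ofReal_deriv_deriv_eq_tsum hδ f, hnorm] at h
  have hmain : (q : ℂ) * (coeff hδ f q * ((q : ℤ) * Complex.I) * ((q : ℤ) * Complex.I) *
        Complex.exp (q * y * Complex.I) +
      coeff hδ f (-q) * ((-q : ℤ) * Complex.I) * ((-q : ℤ) * Complex.I) *
        Complex.exp (-(q * y * Complex.I))) =
      ((-(2 * q ^ 3 * ‖coeff hδ f q‖ * cos (q * y + (coeff hδ f q).arg)) : ℝ) : ℂ) := by
    have h1 := coeff_mul_exp hδ f q y
    have h2 := coeff_neg_mul_exp hδ f q y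
    push_cast at h1 h2 ⊢
    linear_combination (q : ℂ) ^ 3 * Complex.I ^ 2 * h1 + (q : ℂ) ^ 3 * Complex.I ^ 2 * h2 +
      2 * (q : ℂ) ^ 3 * ‖coeff hδ f q‖ * Complex.cos (q * y + (coeff hδ f q).arg) * Complex.I_sq
  rw [hmain, ← Complex.ofReal_sum, ← Complex.ofReal_sub, Complex.norm_real, Real.norm_eq_abs,
    sub_neg_eq_add] at h
  exact h

theorem periodic_deriv {g : ℝ → ℝ} {c : ℝ} (h : Function.Periodic g c) :
    Function.Periodic (deriv g) c := fun x => by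
  rw [← deriv_comp_add_const g c x, funext h]

/-- A function whose `q`-th Fourier coefficient dominates the coefficients of order at least `2q`
has infinitesimal cyclicity at most one at the rotation numbers with denominator `q`. -/
theorem infCyclicity_le_one_of_coeffTail_le {p q : ℕ} (hq : 0 < q) (hpq : p.Coprime q)
    (hc : 0 < ‖coeff hδ f q‖) (ht : coeffTail hδ f q ≤ ‖coeff hδ f q‖ / 2) :
    infCyclicity (f.toCircleFun hδ) ((p : ℝ) / q) ≤ 1 := by
  have hπ := Real.pi_pos
  have hq1 : (1 : ℝ) ≤ q := by exact_mod_cast hq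
  set F := f.toRealFun hδ with hF
  have han : ∀ x, AnalyticAt ℝ F x := analyticAt_toRealFun hδ f
  have hper : Function.Periodic F (2 * π) := f.periodic_toRealFun hδ
  have hlin : ∀ x : ℝ, HasDerivAt (fun x : ℝ => 2 * π * x) (2 * π) x := fun x => by
    simpa using (hasDerivAt_id x).const_mul (2 * π)
  have hc2 : Continuous (deriv (deriv F)) :=
    continuous_iff_continuousAt.2 fun x => (han x).deriv.deriv.continuousAt
  have hpull : ∀ g : ℝ → ℝ, Function.Periodic g (2 * π) → ∀ c : ℝ,
      Function.Periodic (fun x => g (2 * π * x) * c) 1 := fun g hg c x => by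
    simp only
    rw [mul_add, mul_one, hg]
  set C := ‖coeff hδ f q‖ with hC
  set ψ := (coeff hδ f q).arg with hψ
  have harg : ∀ x : ℝ, 2 * π * (q * x + ψ / (2 * π)) = q * (2 * π * x) + ψ := fun x => by
    field_simp
  refine infCyclicity_le_one_of_close hδ f
    (φ₁ := fun x => deriv F (2 * π * x) * (2 * π))
    (φ₂ := fun x => deriv (deriv F) (2 * π * x) * (2 * π) * (2 * π))
    (hasDerivAt_unitFun hδ f)
    (fun x => ((han _).deriv.differentiableAt.hasDerivAt.comp x (hlin x)).mul_const _)
    (by fun_prop) (hpull _ (periodic_deriv hper) _) ?_ hq hpq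
    -- `A` is the amplitude `2 q² C` times the factor `2π` from rescaling the circle. The tail bound
    -- `C/2` then gives errors at most `A/4` and `2πqA/4`, by `q ≥ 1`.
    (A := 4 * π * q ^ 2 * C) (θ := ψ / (2 * π)) (by positivity) (fun x => ?_) (fun x => ?_)
  · simpa only [mul_assoc] using hpull _ (periodic_deriv (periodic_deriv hper)) (2 * π * (2 * π))
  · have h := abs_sum_deriv_add_le hδ f hq hpq (2 * π * x)
    rw [← Finset.sum_mul, harg]
    simp only [mul_add]
    calc _ = 2 * π * |∑ i ∈ Finset.range q, deriv F (2 * π * x + 2 * π * (i * (p / q))) +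
          2 * q ^ 2 * C * sin (q * (2 * π * x) + ψ)| := by
          rw [← abs_of_pos (by positivity : 0 < 2 * π), ← abs_mul,
            abs_of_pos (by positivity : 0 < 2 * π)]
          congr 1
          ring
      _ ≤ 2 * π * (q * coeffTail hδ f q) := by gcongr
      _ ≤ 2 * π * (q * (C / 2)) := by gcongr
      _ ≤ 2 * π * (q * (C / 2)) * q := le_mul_of_one_le_right (by positivity) hq1
      _ = _ := by ring
  · have h := abs_sum_deriv_deriv_add_le hδ f hq hpq (2 * π * x)
    rw [← Finset.sum_mul, ← Finset.sum_mul, harg]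
    simp only [mul_add]
    calc _ = 2 * π * (2 * π) *
          |∑ i ∈ Finset.range q, deriv (deriv F) (2 * π * x + 2 * π * (i * (p / q))) +
          2 * q ^ 3 * C * cos (q * (2 * π * x) + ψ)| := by
          rw [← abs_of_pos (by positivity : 0 < 2 * π * (2 * π)), ← abs_mul]
          congr 1
          ring
      _ ≤ 2 * π * (2 * π) * (q * coeffTail hδ f q) := by gcongr
      _ ≤ 2 * π * (2 * π) * (q * (C / 2)) := by gcongr
      _ ≤ 2 * π * (2 * π) * (q * (C / 2)) * q ^ 2 :=
          le_mul_of_one_le_right (by positivity) (one_le_pow₀ hq1)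
      _ = _ := by ring

/-- Coefficients decay at rate `15δ/16 = 7δ/8 + δ/16`. For `|k| ≥ 2q` the first part yields
`e^{-7δq/4}`, and the second keeps the series with weight `k²` summable. -/
theorem exists_coeffTail_le : ∃ B : ℝ, 0 ≤ B ∧
    ∀ q : ℕ, coeffTail hδ f q ≤ B * Real.exp (-(7 / 4 * δ * q)) := by
  have hS := summable_pow_mul_exp_neg_abs 2 (show 0 < δ / 16 by linarith)
  refine ⟨‖f‖ * ∑' k : ℤ, |(k : ℝ)| ^ 2 * Real.exp (-(δ / 16 * |(k : ℝ)|)),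
    mul_nonneg (norm_nonneg _) (tsum_nonneg fun k => by positivity), fun q => ?_⟩
  have hle : ∀ k : ℤ, (if 2 * (q : ℤ) ≤ |k| then |(k : ℝ)| ^ 2 * ‖coeff hδ f k‖ else 0) ≤
      ‖f‖ * Real.exp (-(7 / 4 * δ * q)) *
        (|(k : ℝ)| ^ 2 * Real.exp (-(δ / 16 * |(k : ℝ)|))) := by
    intro k
    split_ifs with hk
    · have hk' : 2 * (q : ℝ) ≤ |(k : ℝ)| := by
        rw [← Int.cast_abs]
        exact_mod_cast hk
      have h1 := norm_coeff_le hδ f (η := 15 / 16 * δ) (by positivity) (by linarith) k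
      have h2 : Real.exp (-(15 / 16 * δ * |(k : ℝ)|)) ≤
          Real.exp (-(7 / 4 * δ * q)) * Real.exp (-(δ / 16 * |(k : ℝ)|)) := by
        rw [← Real.exp_add]
        refine Real.exp_le_exp.2 ?_
        nlinarith
      calc |(k : ℝ)| ^ 2 * ‖coeff hδ f k‖
          ≤ |(k : ℝ)| ^ 2 * (‖f‖ * (Real.exp (-(7 / 4 * δ * q)) *
            Real.exp (-(δ / 16 * |(k : ℝ)|)))) := by
            refine mul_le_mul_of_nonneg_left (h1.trans ?_) (by positivity)
            exact mul_le_mul_of_nonneg_left h2 (norm_nonneg _)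
        _ = _ := by ring
    · positivity
  have hsr := hS.mul_left (‖f‖ * Real.exp (-(7 / 4 * δ * q)))
  refine (Summable.tsum_le_tsum hle (Summable.of_nonneg_of_le (fun k => ?_) hle hsr) hsr).trans
    (le_of_eq ?_)
  · split_ifs <;> positivity
  · rw [tsum_mul_left]
    ring

/-- The ratio of the tail to the lower bound is of order `q² e^{-δq/2}`, which tends to zero. -/
theorem mem_essentialIC_of_eventually_le
    (h : ∀ᶠ q : ℕ in atTop, Real.exp (-(5 / 4 * δ * q)) / (q + 1) ^ 2 ≤ ‖coeff hδ f q‖) :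
    f ∈ essentialIC 1 hδ := by
  obtain ⟨B, hB, htail⟩ := exists_coeffTail_le hδ f
  have hlim : Tendsto (fun q : ℕ => 8 * B * ((q : ℝ) ^ 2 * Real.exp (-(δ / 2) * q))) atTop
      (𝓝 0) := by
    simpa using ((Real.summable_pow_mul_exp_neg_nat_mul 2 (half_pos hδ)).tendsto_atTop_zero).const_mul
      (8 * B)
  obtain ⟨Q, hQ⟩ := eventually_atTop.1 (h.and (hlim.eventually (gt_mem_nhds one_pos)))
  refine ⟨Q, fun p q hq hQq hpq => ?_⟩
  obtain ⟨h1, h2⟩ := hQ q hQq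
  have hq1 : (1 : ℝ) ≤ q := by exact_mod_cast hq
  refine infCyclicity_le_one_of_coeffTail_le hδ f hq hpq (lt_of_lt_of_le (by positivity) h1) ?_
  refine (htail q).trans (le_trans ?_ (div_le_div_of_nonneg_right h1 zero_le_two))
  rw [div_div, le_div_iff₀ (by positivity)]
  have h3 : Real.exp (-(7 / 4 * δ * q)) =
      Real.exp (-(δ / 2) * q) * Real.exp (-(5 / 4 * δ * q)) := by
    rw [← Real.exp_add]
    congr 1
    ring
  rw [h3]
  have h4 : ((q : ℝ) + 1) ^ 2 ≤ 4 * q ^ 2 := by nlinarith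
  calc B * (Real.exp (-(δ / 2) * q) * Real.exp (-(5 / 4 * δ * q))) * (((q : ℝ) + 1) ^ 2 * 2)
      ≤ B * (Real.exp (-(δ / 2) * q) * Real.exp (-(5 / 4 * δ * q))) * (4 * q ^ 2 * 2) := by gcongr
    _ = 8 * B * ((q : ℝ) ^ 2 * Real.exp (-(δ / 2) * q)) * Real.exp (-(5 / 4 * δ * q)) := by ring
    _ ≤ 1 * Real.exp (-(5 / 4 * δ * q)) := by gcongr
    _ = _ := one_mul _

end Nondegenerate

/-! ### The probe -/

section Probe

variable {δ : ℝ}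

/-- `1 / (1 - ρ e^{iz}) + 1 / (1 - ρ e^{-iz})` with `ρ = e^{-5δ/4}`. -/
noncomputable def probeFun (δ : ℝ) (z : ℂ) : ℂ :=
  (1 - Real.exp (-(5 / 4 * δ)) * Complex.exp (z * Complex.I))⁻¹ +
    (1 - Real.exp (-(5 / 4 * δ)) * Complex.exp (-(z * Complex.I)))⁻¹

/-- The rate `5δ/4` leaves a margin `δ/4` over the half-width of the strip, which keeps the
denominators of the probe away from zero uniformly. -/
theorem norm_exp_mul_exp_le {w : ℂ} (hw : |w.re| < δ) :
    ‖(Real.exp (-(5 / 4 * δ)) : ℂ) * Complex.exp w‖ ≤ Real.exp (-(δ / 4)) := by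
  rw [norm_mul, Complex.norm_real, Real.norm_of_nonneg (Real.exp_nonneg _), Complex.norm_exp,
    ← Real.exp_add]
  refine Real.exp_le_exp.2 ?_
  linarith [(abs_lt.1 hw).2]

theorem abs_re_mul_I_lt {z : ℂ} (hz : z ∈ strip δ) :
    |(z * Complex.I).re| < δ ∧ |(-(z * Complex.I)).re| < δ := by
  have h : |z.im| < δ := hz
  simpa using h

theorem one_sub_ne_zero_and_norm_inv_le (hδ : 0 < δ) {u : ℂ} (hu : ‖u‖ ≤ Real.exp (-(δ / 4))) :
    1 - u ≠ 0 ∧ ‖(1 - u)⁻¹‖ ≤ (1 - Real.exp (-(δ / 4)))⁻¹ := by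
  have h1 : Real.exp (-(δ / 4)) < 1 := by rw [Real.exp_lt_one_iff]; linarith
  have h2 : 1 - Real.exp (-(δ / 4)) ≤ ‖1 - u‖ := by
    have := norm_sub_norm_le 1 u
    rw [norm_one] at this
    linarith
  constructor
  · intro h
    rw [h, norm_zero] at h2
    linarith
  · rw [norm_inv]
    exact inv_anti₀ (by linarith) h2

theorem differentiableOn_probeFun (hδ : 0 < δ) : DifferentiableOn ℂ (probeFun δ) (strip δ) := by
  intro z hz
  have h1 := (one_sub_ne_zero_and_norm_inv_le hδ (norm_exp_mul_exp_le (abs_re_mul_I_lt hz).1)).1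
  have h2 := (one_sub_ne_zero_and_norm_inv_le hδ (norm_exp_mul_exp_le (abs_re_mul_I_lt hz).2)).1
  refine DifferentiableAt.differentiableWithinAt ?_
  have d1 : DifferentiableAt ℂ
      (fun z => 1 - (Real.exp (-(5 / 4 * δ)) : ℂ) * Complex.exp (z * Complex.I)) z := by fun_prop
  have d2 : DifferentiableAt ℂ
      (fun z => 1 - (Real.exp (-(5 / 4 * δ)) : ℂ) * Complex.exp (-(z * Complex.I))) z := by fun_prop
  exact (d1.inv h1).add (d2.inv h2)

theorem norm_probeFun_le (hδ : 0 < δ) {z : ℂ} (hz : z ∈ strip δ) :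
    ‖probeFun δ z‖ ≤ 2 * (1 - Real.exp (-(δ / 4)))⁻¹ := by
  have h1 := (one_sub_ne_zero_and_norm_inv_le hδ (norm_exp_mul_exp_le (abs_re_mul_I_lt hz).1)).2
  have h2 := (one_sub_ne_zero_and_norm_inv_le hδ (norm_exp_mul_exp_le (abs_re_mul_I_lt hz).2)).2
  exact (norm_add_le _ _).trans (by linarith)

theorem probeFun_add_two_pi (z : ℂ) : probeFun δ (z + ((2 * π : ℝ) : ℂ)) = probeFun δ z := by
  have h1 : Complex.exp ((z + ((2 * π : ℝ) : ℂ)) * Complex.I) = Complex.exp (z * Complex.I) := by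
    rw [← Complex.exp_periodic (z * Complex.I)]
    congr 1
    push_cast
    ring
  rw [probeFun, probeFun, Complex.exp_neg, Complex.exp_neg, h1]

theorem probeFun_ofReal_im (x : ℝ) : (probeFun δ x).im = 0 := by
  rw [← Complex.conj_eq_iff_im, probeFun]
  simp only [map_add, map_inv₀, map_sub, map_one, map_mul, Complex.conj_ofReal, ← Complex.exp_conj,
    map_neg, Complex.conj_I, mul_neg, neg_neg]
  rw [add_comm]

/-- The element of the analytic space given by `probeFun`. -/
noncomputable def probe (hδ : 0 < δ) : AnalyticCircleSpace δ :=
  ⟨BoundedContinuousFunction.ofNormedAddCommGroup (fun z : strip δ => probeFun δ z)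
    ((differentiableOn_probeFun hδ).continuousOn.domRestrict) (2 * (1 - Real.exp (-(δ / 4)))⁻¹)
    (fun z => norm_probeFun_le hδ z.2),
    probeFun δ, differentiableOn_probeFun hδ, fun _ => rfl, fun z _ => probeFun_add_two_pi z,
    fun x _ => probeFun_ofReal_im x⟩

theorem ofReal_toRealFun_probe (hδ : 0 < δ) (x : ℝ) :
    ((probe hδ).toRealFun hδ x : ℂ) = probeFun δ x :=
  Complex.ext rfl (by simp [probeFun_ofReal_im])

theorem coeff_eq_integral_toRealFun (hδ : 0 < δ) (f : AnalyticCircleSpace δ) (k : ℤ) :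
    coeff hδ f k = ((1 / (2 * π) : ℝ) : ℂ) * ∫ x in (0 : ℝ)..2 * π,
      Complex.exp (-(k * x * Complex.I)) * f.toRealFun hδ x := by
  rw [coeff_eq_integral]
  simp only [ofReal_toRealFun]

theorem coeff_smul_sub (hδ : 0 < δ) (t : ℝ) (g f : AnalyticCircleSpace δ) (k : ℤ) :
    coeff hδ (t • g - f) k = t * coeff hδ g k - coeff hδ f k := by
  have hc : ∀ h : AnalyticCircleSpace δ, Continuous fun x : ℝ =>
      Complex.exp (-(k * x * Complex.I)) * (h.toRealFun hδ x : ℂ) := by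
    intro h
    have : Continuous (h.toRealFun hδ) :=
      continuous_iff_continuousAt.2 fun y => (analyticAt_toRealFun hδ h y).continuousAt
    fun_prop
  have hlin : ∀ x, (t • g - f).toRealFun hδ x = t * g.toRealFun hδ x - f.toRealFun hδ x := by
    intro x
    simp [AnalyticCircleSpace.toRealFun]
  have hint : ∫ x in (0 : ℝ)..2 * π,
      Complex.exp (-(k * x * Complex.I)) * ((t • g - f).toRealFun hδ x : ℂ) =
      t * (∫ x in (0 : ℝ)..2 * π, Complex.exp (-(k * x * Complex.I)) * (g.toRealFun hδ x : ℂ)) -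
      ∫ x in (0 : ℝ)..2 * π, Complex.exp (-(k * x * Complex.I)) * (f.toRealFun hδ x : ℂ) := by
    rw [← intervalIntegral.integral_const_mul, ← intervalIntegral.integral_sub
      (((hc g).const_mul _).intervalIntegrable _ _) ((hc f).intervalIntegrable _ _)]
    refine intervalIntegral.integral_congr fun x _ => ?_
    simp only [hlin]
    push_cast
    ring
  rw [coeff_eq_integral_toRealFun, coeff_eq_integral_toRealFun, coeff_eq_integral_toRealFun, hint]
  ring

theorem integral_exp_int_mul_I (m : ℤ) :
    ∫ x in (0 : ℝ)..2 * π, Complex.exp (m * x * Complex.I) =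
      if m = 0 then ((2 * π : ℝ) : ℂ) else 0 := by
  split_ifs with h
  · simp [h]
  · have hm : (m : ℂ) * Complex.I ≠ 0 := mul_ne_zero (by exact_mod_cast h) Complex.I_ne_zero
    have h1 : ∀ x : ℝ, (m : ℂ) * x * Complex.I = m * Complex.I * x := fun x => by ring
    simp only [h1]
    rw [integral_exp_mul_complex hm]
    have h2 : (m : ℂ) * Complex.I * ((2 * π : ℝ) : ℂ) = m * (2 * π * Complex.I) := by
      push_cast
      ring
    rw [h2, Complex.exp_int_mul_two_pi_mul_I]
    simp

/-- Both fractions are expanded as geometric series on the real axis and integrated termwise. For `q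
> 0` only the term `n = q` of the first series contributes; at `q = 0` both series would. -/
theorem coeff_probe (hδ : 0 < δ) {q : ℕ} (hq : 0 < q) :
    coeff hδ (probe hδ) q = Real.exp (-(5 / 4 * δ * q)) := by
  have hπ := Real.pi_pos
  set ρ := Real.exp (-(5 / 4 * δ)) with hρ
  have hρ0 : 0 < ρ := Real.exp_pos _
  have hρ1 : ρ < 1 := by rw [Real.exp_lt_one_iff]; linarith
  set a : ℕ → ℝ → ℂ := fun n x => (ρ : ℂ) ^ n *
    (Complex.exp (((n - q : ℤ) : ℂ) * x * Complex.I) +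
      Complex.exp (((-n - q : ℤ) : ℂ) * x * Complex.I)) with ha
  have hgeom : ∀ w : ℂ, ‖Complex.exp w‖ = 1 →
      HasSum (fun n : ℕ => ((ρ : ℂ) * Complex.exp w) ^ n) (1 - ρ * Complex.exp w)⁻¹ := by
    intro w hw
    refine hasSum_geometric_of_norm_lt_one ?_
    rw [norm_mul, hw, mul_one, Complex.norm_real, Real.norm_of_nonneg hρ0.le]
    exact hρ1
  have hpt : ∀ x : ℝ, HasSum (fun n => a n x)
      (Complex.exp (-(((q : ℤ) : ℂ) * x * Complex.I)) * (probe hδ).toRealFun hδ x) := by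
    intro x
    have n1 : ‖Complex.exp (x * Complex.I)‖ = 1 := Complex.norm_exp_ofReal_mul_I x
    have n2 : ‖Complex.exp (-(x * Complex.I))‖ = 1 := by
      rw [Complex.exp_neg, norm_inv, n1, inv_one]
    have h := ((hgeom _ n1).add (hgeom _ n2)).mul_left (Complex.exp (-(((q : ℤ) : ℂ) * x * Complex.I)))
    rw [ofReal_toRealFun_probe, probeFun]
    refine h.congr_fun fun n => ?_
    simp only [ha]
    rw [mul_pow, mul_pow, ← mul_add, mul_left_comm, mul_add (Complex.exp _), ← Complex.exp_nat_mul,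
      ← Complex.exp_nat_mul, ← Complex.exp_add, ← Complex.exp_add]
    congr 3 <;> push_cast <;> ring
  have hbound : ∀ n x, ‖a n x‖ ≤ ρ ^ n * 2 := by
    intro n x
    simp only [ha]
    rw [norm_mul, norm_pow, Complex.norm_real, Real.norm_of_nonneg hρ0.le]
    refine mul_le_mul_of_nonneg_left ((norm_add_le _ _).trans ?_) (by positivity)
    rw [norm_exp_int_mul_I, norm_exp_int_mul_I]
    norm_num
  have hint := intervalIntegral.hasSum_integral_of_dominated_convergence (μ := volume)
    (a := 0) (b := 2 * π) (F := a) (fun n _ => ρ ^ n * 2)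
    (fun n => (by fun_prop : Continuous (a n)).aestronglyMeasurable)
    (fun n => Eventually.of_forall fun x _ => hbound n x)
    (Eventually.of_forall fun x _ => (summable_geometric_of_lt_one hρ0.le hρ1).mul_right 2)
    (by simp) (Eventually.of_forall fun x _ => hpt x)
  have hval : ∀ n, ∫ x in (0 : ℝ)..2 * π, a n x =
      if n = q then (ρ : ℂ) ^ q * ((2 * π : ℝ) : ℂ) else 0 := by
    intro n
    simp only [ha]
    rw [intervalIntegral.integral_const_mul, intervalIntegral.integral_add
      ((by fun_prop : Continuous _).intervalIntegrable _ _)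
      ((by fun_prop : Continuous _).intervalIntegrable _ _),
      integral_exp_int_mul_I, integral_exp_int_mul_I, if_neg (by omega : ¬(-n - q : ℤ) = 0), add_zero]
    by_cases h : n = q
    · rw [if_pos (by omega), if_pos h, h]
    · rw [if_neg (by omega), if_neg h, mul_zero]
  simp only [hval] at hint
  have huniq := hint.unique (hasSum_ite_eq q ((ρ : ℂ) ^ q * ((2 * π : ℝ) : ℂ)))
  rw [coeff_eq_integral_toRealFun, huniq, hρ, ← Complex.ofReal_pow, ← Real.exp_nat_mul]
  have : (π : ℂ) ≠ 0 := by exact_mod_cast hπ.ne'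
  push_cast
  field_simp

/-- Borel–Cantelli: the `q`-th coefficient is affine in `t` with slope `e^{-5δq/4}`, so it is too
small only for `t` in an interval of length `2/(q+1)²`. These lengths are summable. -/
theorem ae_smul_probe_sub_mem (hδ : 0 < δ) (f : AnalyticCircleSpace δ) :
    ∀ᵐ t : ℝ, t • probe hδ - f ∈ essentialIC 1 hδ := by
  set s : ℕ → Set ℝ := fun q =>
    Metric.ball ((coeff hδ f q).re / Real.exp (-(5 / 4 * δ * q))) (1 / ((q : ℝ) + 1) ^ 2) with hs
  have hsum : Summable fun q : ℕ => 2 * (1 / ((q : ℝ) + 1) ^ 2) := by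
    have := (summable_nat_add_iff 1).2 (Real.summable_one_div_nat_pow.2 one_lt_two)
    refine Summable.mul_left 2 ?_
    simpa using this
  have hfin : ∑' q, volume (s q) ≠ ⊤ := by
    simp only [hs, Real.volume_ball]
    exact hsum.tsum_ofReal_ne_top
  filter_upwards [ae_eventually_notMem hfin] with t ht
  refine mem_essentialIC_of_eventually_le hδ _ ?_
  filter_upwards [ht, eventually_gt_atTop 0] with q hq hq0
  set e := Real.exp (-(5 / 4 * δ * q)) with he
  have he0 : 0 < e := Real.exp_pos _
  rw [hs, Metric.mem_ball, not_lt, Real.dist_eq] at hq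
  -- The slope is real, so the real part of the coefficient alone gives the lower bound.
  refine le_trans ?_ (Complex.abs_re_le_norm _)
  rw [coeff_smul_sub, coeff_probe hδ hq0, Complex.sub_re, ← Complex.ofReal_mul, Complex.ofReal_re]
  have h1 : t * e - (coeff hδ f q).re = e * (t - (coeff hδ f q).re / e) := by
    field_simp
  rw [h1, abs_mul, abs_of_pos he0]
  calc e / ((q : ℝ) + 1) ^ 2 = e * (1 / ((q : ℝ) + 1) ^ 2) := by ring
    _ ≤ _ := by gcongr

end Probe

/-! ### Prevalence -/

theorem mainTheorem4 (δ : ℝ) (hδ : 0 < δ) :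
    IsHaarPrevalent (essentialIC 1 hδ) := by
  have hmeas := (measurableSet_essentialIC_one hδ).compl
  have hc : Continuous fun t : ℝ => t • probe hδ := by fun_prop
  -- The measure is the uniform one on the segment from `0` to the probe. The translate by `f` of
  -- the bad set receives the measure of the `t` in `[0, 1]` for which `t • probe - f` is bad.
  refine ⟨hmeas, (volume.restrict (Set.Icc (0 : ℝ) 1)).map fun t => t • probe hδ, ?_, fun f => ?_⟩
  · have : IsProbabilityMeasure (volume.restrict (Set.Icc (0 : ℝ) 1)) := ⟨by simp⟩
    exact Measure.isProbabilityMeasure_map hc.measurable.aemeasurable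
  · have himg : (fun y => f + y) '' (essentialIC 1 hδ)ᶜ = (fun y => y - f) ⁻¹' (essentialIC 1 hδ)ᶜ := by
      ext y
      constructor
      · rintro ⟨w, hw, rfl⟩
        simpa using hw
      · intro hy
        exact ⟨y - f, hy, by simp⟩
    have hsub : Continuous fun y : AnalyticCircleSpace δ => y - f := by fun_prop
    rw [himg, Measure.map_apply hc.measurable (hsub.measurable hmeas)]
    exact le_antisymm ((Measure.restrict_apply_le _ _).trans
      (ae_smul_probe_sub_mem hδ f).le) bot_le
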